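/- Let $k$ be a field. By a *graded algebra* we mean a $k$-algebra $\Lambda=\bigoplus_{i\ge 0}\Lambda_i$, graded by the non-negative integers, with $\dim_k\Lambda_i<\infty$ for all $i$, and such that $\Lambda_0$ is augmented over $k^{\times r}$ for some $r>0$, i.e. there are $k$-algebra maps $k^{\times r}\to\Lambda_0\to k^{\times r}$ with composite the identity, the kernel of the second map being the radical of $\Lambda_0$. Let $\mathrm{Gr}\,\Lambda$ be the abelian category of $\mathbb Z$-graded left $\Lambda$-modules with degree $0$ morphisms, let $M\langle j\rangle$ be the shift with $(M\langle j\rangle)_i=M_{i-j}$, and let $DM$ be the graded dual of $M$, the graded $\Lambda^{\mathrm{op}}$-module with $(DM)_i=\mathrm{Hom}_k(M_{-i},k)$. A module is *basic* if its indecomposable direct summands are pairwise non-isomorphic. A finitely generated basic module $T$ over a finite dimensional algebra $A$ is a *tilting module* if $\mathrm{pd}\,T<\infty$, $\mathrm{Ext}^i_A(T,T)=0$ for all $i>0$, and there is an exact sequence $0\to A\to T_0\to T_1\to\cdots\to T_n\to 0$ with every $T_i$ in $\mathrm{add}\,T$ (the direct summands of finite direct sums of copies of $T$). Let $\Lambda$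 be a graded algebra with $\mathrm{gldim}\,\Lambda_0<\infty$ and let $T$ be a graded $\Lambda$-module concentrated in degree $0$. We say that $\Lambda$ is *Koszul with respect to $T$* if (i) $T$ is a tilting $\Lambda_0$-module, and (ii) $T$ is graded self-orthogonal as a $\Lambda$-module, that is, $T$ is finitely generated and basic, and $\mathrm{Ext}^i_{\mathrm{Gr}\,\Lambda}(T,T\langle j\rangle)=0$ for all $i\geq 0$ and $j\in\mathbb Z$ with $i\ne j$. **Theorem.** Let $\Lambda=\bigoplus_{i\ge0}\Lambda_i$ be a graded algebra with $\mathrm{gldim}\,\Lambda_0<\infty$. Suppose that $\Lambda$ is Koszul with respect to a module $T$. Then $\Lambda^{\mathrm{op}}$ (with the grading $(\Lambda^{\mathrm{op}})_i=\Lambda_i$) is again a graded algebra in the above sense, $\mathrm{gldim}\,\Lambda_0^{\mathrm{op}}<\infty$, and $\Lambda^{\mathrm{op}}$ is Koszul with respect to $DT$. -/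

import Mathlib

open CategoryTheory CategoryTheory.Limits

universe u v w

/-! ## Graded modules over a positively graded algebra

`𝒜 : ℕ → Submodule k Λ` with `[GradedAlgebra 𝒜]` is Mathlib's notion of a grading
`Λ = ⨁_{i ≥ 0} Λ_i` of the `k`-algebra `Λ`, and `𝒜 i` is `Λ_i`. -/

section GradedModules

variable {k : Type u} [Field k] {Λ : Type u} [Ring Λ] [Algebra k Λ]

/-- A graded left `Λ`-module `M = ⨁_{i ∈ ℤ} M_i`, given by its homogeneous parts `M_i`
(`k`-vector spaces) together with the multiplications `Λ_i × M_j → M_{i+j}`.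
(The target degree `l` is kept as a variable with `i + j = l`, to avoid casts.) -/
structure GrMod (𝒜 : ℕ → Submodule k Λ) [GradedAlgebra 𝒜] where
  /-- the homogeneous parts -/
  X : ℤ → Type u
  [addCommGroup : ∀ i, AddCommGroup (X i)]
  [module : ∀ i, Module k (X i)]
  /-- the action of homogeneous elements -/
  act : ∀ (i : ℕ) (j l : ℤ), (i : ℤ) + j = l → (𝒜 i →ₗ[k] X j →ₗ[k] X l)
  one_act : ∀ (j : ℤ) (h : ((0 : ℕ) : ℤ) + j = j) (m : X j),
    act 0 j j h ⟨1, SetLike.GradedOne.one_mem⟩ m = m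
  mul_act : ∀ (i i' : ℕ) (j j' l : ℤ) (h : (i' : ℤ) + j = j') (h' : (i : ℤ) + j' = l)
    (h'' : ((i + i' : ℕ) : ℤ) + j = l) (a : 𝒜 i) (b : 𝒜 i') (m : X j),
    act (i + i') j l h'' ⟨(a : Λ) * (b : Λ), SetLike.mul_mem_graded a.2 b.2⟩ m =
      act i j' l h' a (act i' j j' h b m)

attribute [instance] GrMod.addCommGroup GrMod.module

namespace GrMod

variable {𝒜 : ℕ → Submodule k Λ} [GradedAlgebra 𝒜]

/-- A morphism of graded modules: a degree-preserving `Λ`-linear map. -/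
@[ext]
structure Hom (M N : GrMod 𝒜) where
  app : ∀ i : ℤ, M.X i →ₗ[k] N.X i
  comm : ∀ (i : ℕ) (j l : ℤ) (h : (i : ℤ) + j = l) (a : 𝒜 i) (m : M.X j),
    app l (M.act i j l h a m) = N.act i j l h a (app j m)

/-- The category `Gr Λ` of graded modules with degree `0` morphisms. -/
instance : Category (GrMod 𝒜) where
  Hom := Hom
  id M := { app := fun _ => LinearMap.id, comm := fun _ _ _ _ _ _ => rfl }
  comp f g :=
    { app := fun i => (g.app i).comp (f.app i)
      comm := fun i j l h a m => by simp [f.comm, g.comm] }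

@[simp] lemma id_app (M : GrMod 𝒜) (i : ℤ) (m : M.X i) : Hom.app (𝟙 M) i m = m := rfl

@[simp] lemma comp_app {M N P : GrMod 𝒜} (f : M ⟶ N) (g : N ⟶ P) (i : ℤ) (m : M.X i) :
    Hom.app (f ≫ g) i m = g.app i (f.app i m) := rfl

lemma hom_ext {M N : GrMod 𝒜} {f g : M ⟶ N} (h : ∀ i m, f.app i m = g.app i m) : f = g :=
  Hom.ext (funext fun i => LinearMap.ext (h i))

instance (M N : GrMod 𝒜) : Zero (M ⟶ N) :=
  ⟨{ app := fun _ => 0, comm := fun _ _ _ _ _ _ => by simp }⟩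

instance (M N : GrMod 𝒜) : Add (M ⟶ N) :=
  ⟨fun f g => { app := fun i => f.app i + g.app i
                comm := fun _ _ _ _ _ _ => by simp [f.comm, g.comm] }⟩

instance (M N : GrMod 𝒜) : Neg (M ⟶ N) :=
  ⟨fun f => { app := fun i => - f.app i, comm := fun _ _ _ _ _ _ => by simp [f.comm] }⟩

@[simp] lemma zero_app (M N : GrMod 𝒜) (i : ℤ) (m : M.X i) :
    Hom.app (0 : M ⟶ N) i m = 0 := rfl

@[simp] lemma add_app {M N : GrMod 𝒜} (f g : M ⟶ N) (i : ℤ) (m : M.X i) :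
    Hom.app (f + g) i m = f.app i m + g.app i m := rfl

@[simp] lemma neg_app {M N : GrMod 𝒜} (f : M ⟶ N) (i : ℤ) (m : M.X i) :
    Hom.app (-f) i m = - f.app i m := rfl

instance (M N : GrMod 𝒜) : AddCommGroup (M ⟶ N) where
  add_assoc f g h := hom_ext fun i m => by simp [add_assoc]
  zero_add f := hom_ext fun i m => by simp
  add_zero f := hom_ext fun i m => by simp
  add_comm f g := hom_ext fun i m => by simp [add_comm]
  neg_add_cancel f := hom_ext fun i m => by simp
  nsmul := nsmulRec
  zsmul := zsmulRec

instance : Preadditive (GrMod 𝒜) where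
  add_comp M N P f f' g := hom_ext fun i m => by simp
  comp_add M N P f g g' := hom_ext fun i m => by simp

/-- The kernel of a morphism, degree by degree. -/
def ker {M N : GrMod 𝒜} (f : M ⟶ N) : GrMod 𝒜 where
  X i := LinearMap.ker (f.app i)
  act i j l h := LinearMap.mk₂ k
    (fun a m => ⟨M.act i j l h a m.1, by
      rw [LinearMap.mem_ker, f.comm, LinearMap.mem_ker.1 m.2, map_zero]⟩)
    (fun a b m => Subtype.ext (by simp)) (fun c a m => Subtype.ext (by simp))
    (fun a m n => Subtype.ext (by simp)) (fun c a m => Subtype.ext (by simp))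
  one_act j h m := Subtype.ext (M.one_act j h m.1)
  mul_act i i' j j' l h h' h'' a b m := Subtype.ext (M.mul_act i i' j j' l h h' h'' a b m.1)

/-- The inclusion of the kernel. -/
def kerι {M N : GrMod 𝒜} (f : M ⟶ N) : ker f ⟶ M where
  app i := (LinearMap.ker (f.app i)).subtype
  comm _ _ _ _ _ _ := rfl

/-- The cokernel of a morphism, degree by degree. -/
def coker {M N : GrMod 𝒜} (f : M ⟶ N) : GrMod 𝒜 where
  X i := N.X i ⧸ LinearMap.range (f.app i)
  act i j l h :=
    { toFun := fun a => Submodule.mapQ _ _ (N.act i j l h a) (by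
        rintro _ ⟨m, rfl⟩
        exact ⟨M.act i j l h a m, f.comm i j l h a m⟩)
      map_add' := fun a b => by ext m; simp
      map_smul' := fun c a => by ext m; simp }
  one_act j h m := by
    obtain ⟨m, rfl⟩ := Submodule.mkQ_surjective _ m
    exact congrArg (Submodule.mkQ _) (N.one_act j h m)
  mul_act i i' j j' l h h' h'' a b m := by
    obtain ⟨m, rfl⟩ := Submodule.mkQ_surjective _ m
    exact congrArg (Submodule.mkQ _) (N.mul_act i i' j j' l h h' h'' a b m)

/-- The projection to the cokernel. -/
def cokerπ {M N : GrMod 𝒜} (f : M ⟶ N) : N ⟶ coker f where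
  app _ := Submodule.mkQ _
  comm _ _ _ _ _ _ := rfl

lemma cokerπ_surjective {M N : GrMod 𝒜} (f : M ⟶ N) (i : ℤ) :
    Function.Surjective ((cokerπ f).app i) := Submodule.mkQ_surjective _

/-- A morphism killed by `f` factors uniquely through any degreewise injective `ι` whose
image is degreewise the kernel of `f`. -/
noncomputable def isLimitOfExact {K M N : GrMod 𝒜} (ι : K ⟶ M) (f : M ⟶ N) (w : ι ≫ f = 0)
    (inj : ∀ i, Function.Injective (ι.app i))
    (ex : ∀ i m, f.app i m = 0 → ∃ x, ι.app i x = m) : IsLimit (KernelFork.ofι ι w) :=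
  have key : ∀ {P : GrMod 𝒜} (g : P ⟶ M), g ≫ f = 0 →
      ∃ g' : P ⟶ K, g' ≫ ι = g := fun {P} g hg => by
    have H : ∀ i m, ∃ x, ι.app i x = g.app i m := fun i m =>
      ex i _ (congrArg (fun t : P ⟶ N => Hom.app t i m) hg)
    choose s hs using H
    refine ⟨{ app := fun i => { toFun := s i, map_add' := ?_, map_smul' := ?_ }, comm := ?_ }, ?_⟩
    · intro x y; apply inj; simp [hs]
    · intro c x; apply inj; simp [hs]
    · intro i j l h a m; apply inj; simp [hs, ι.comm, g.comm]
    · exact hom_ext fun i m => hs i m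
  KernelFork.IsLimit.ofι ι w (fun g hg => (key g hg).choose)
    (fun g hg => (key g hg).choose_spec)
    (fun g hg m hm => hom_ext fun i x => inj i (by
      have h1 := congrArg (fun t => Hom.app t i x) hm
      have h2 := congrArg (fun t => Hom.app t i x) (key g hg).choose_spec
      simpa using h1.trans h2.symm))

/-- The dual of `isLimitOfExact`. -/
noncomputable def isColimitOfExact {K M N : GrMod 𝒜} (f : K ⟶ M) (p : M ⟶ N) (w : f ≫ p = 0)
    (surj : ∀ i, Function.Surjective (p.app i))
    (ex : ∀ i m, p.app i m = 0 → ∃ x, f.app i x = m) : IsColimit (CokernelCofork.ofπ p w) :=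
  have key : ∀ {P : GrMod 𝒜} (g : M ⟶ P), f ≫ g = 0 →
      ∃ g' : N ⟶ P, p ≫ g' = g := fun {P} g hg => by
    have H : ∀ i m m', p.app i m = p.app i m' → g.app i m = g.app i m' := fun i m m' h => by
      obtain ⟨x, hx⟩ := ex i (m - m') (by rw [map_sub, h, sub_self])
      have : g.app i (f.app i x) = 0 := congrArg (fun t : K ⟶ P => Hom.app t i x) hg
      rw [hx, map_sub, sub_eq_zero] at this
      exact this
    choose s hs using surj
    have hg' : ∀ i m, g.app i (s i (p.app i m)) = g.app i m := fun i m => H i _ _ (hs i _)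
    refine ⟨{ app := fun i => { toFun := fun x => g.app i (s i x), map_add' := ?_,
                                map_smul' := ?_ }, comm := ?_ }, ?_⟩
    · intro x y
      rw [← map_add]; apply H; simp [hs]
    · intro c x
      rw [RingHom.id_apply, ← map_smul]; apply H; simp [hs]
    · intro i j l h a m
      change g.app l (s l _) = P.act i j l h a (g.app j (s j m))
      rw [← g.comm]; apply H; simp [hs, p.comm]
    · exact hom_ext fun i m => hg' i m
  CokernelCofork.IsColimit.ofπ p w (fun g hg => (key g hg).choose)
    (fun g hg => (key g hg).choose_spec)
    (fun g hg m hm => hom_ext fun i x => by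
      obtain ⟨y, rfl⟩ := surj i x
      have h1 := congrArg (fun t => Hom.app t i y) hm
      have h2 := congrArg (fun t => Hom.app t i y) (key g hg).choose_spec
      simpa using h1.trans h2.symm)

lemma kerι_comp {M N : GrMod 𝒜} (f : M ⟶ N) : kerι f ≫ f = 0 :=
  hom_ext fun _ m => LinearMap.mem_ker.1 m.2

lemma comp_cokerπ {M N : GrMod 𝒜} (f : M ⟶ N) : f ≫ cokerπ f = 0 :=
  hom_ext fun _ m => (Submodule.Quotient.mk_eq_zero _).2 ⟨m, rfl⟩

lemma cokerπ_eq_zero {M N : GrMod 𝒜} (f : M ⟶ N) (i : ℤ) (m : N.X i)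
    (h : (cokerπ f).app i m = 0) : ∃ x, f.app i x = m :=
  (Submodule.Quotient.mk_eq_zero _).1 h

instance : HasKernels (GrMod 𝒜) where
  has_limit f := ⟨⟨⟨_, isLimitOfExact (kerι f) f (kerι_comp f)
    (fun _ => Subtype.val_injective) (fun _ m h => ⟨⟨m, h⟩, rfl⟩)⟩⟩⟩

instance : HasCokernels (GrMod 𝒜) where
  has_colimit f := ⟨⟨⟨_, isColimitOfExact f (cokerπ f) (comp_cokerπ f)
    (cokerπ_surjective f) (cokerπ_eq_zero f)⟩⟩⟩

lemma injective_of_mono {M N : GrMod 𝒜} (f : M ⟶ N) [Mono f] (i : ℤ) :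
    Function.Injective (f.app i) := by
  rw [injective_iff_map_eq_zero]
  intro m hm
  have : kerι f = 0 := by rw [← cancel_mono f, kerι_comp, zero_comp]
  exact congrArg (fun t : ker f ⟶ M => Hom.app t i ⟨m, hm⟩) this

lemma surjective_of_epi {M N : GrMod 𝒜} (f : M ⟶ N) [Epi f] (i : ℤ) :
    Function.Surjective (f.app i) := by
  intro m
  have : cokerπ f = 0 := by rw [← cancel_epi f, comp_cokerπ, comp_zero]
  exact cokerπ_eq_zero f i m (congrArg (fun t : N ⟶ coker f => Hom.app t i m) this)

instance : IsNormalMonoCategory (GrMod 𝒜) where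
  normalMonoOfMono f _ := ⟨
    { Z := coker f
      g := cokerπ f
      w := comp_cokerπ f
      isLimit := isLimitOfExact _ _ _ (injective_of_mono f) (cokerπ_eq_zero f) }⟩

instance : IsNormalEpiCategory (GrMod 𝒜) where
  normalEpiOfEpi f _ := ⟨
    { W := ker f
      g := kerι f
      w := kerι_comp f
      isColimit := isColimitOfExact _ _ _ (surjective_of_epi f) (fun _ m h => ⟨⟨m, h⟩, rfl⟩) }⟩

/-- The product of a family of graded modules, degree by degree. -/
def pi {J : Type} (M : J → GrMod 𝒜) : GrMod 𝒜 where
  X i := ∀ s, (M s).X i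
  act i j l h := LinearMap.mk₂ k (fun a m s => (M s).act i j l h a (m s))
    (fun a b m => by ext; simp) (fun c a m => by ext; simp)
    (fun a m n => by ext; simp) (fun c a m => by ext; simp)
  one_act j h m := funext fun s => (M s).one_act j h (m s)
  mul_act i i' j j' l h h' h'' a b m :=
    funext fun s => (M s).mul_act i i' j j' l h h' h'' a b (m s)

/-- The projections from the product. -/
def piFan {J : Type} (M : J → GrMod 𝒜) : Fan M :=
  Fan.mk (pi M) fun s => { app := fun _ => LinearMap.proj s, comm := fun _ _ _ _ _ _ => rfl }

/-- The universal property of the product. -/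
def piFanIsLimit {J : Type} (M : J → GrMod 𝒜) : IsLimit (piFan M) :=
  Fan.IsLimit.mk (piFan M)
    (fun c =>
      { app := fun i => LinearMap.pi fun s => Hom.app (c.proj s) i
        comm := fun i j l h a m => funext fun s => Hom.comm (c.proj s) i j l h a m })
    (fun _ _ => rfl)
    (fun _ _ hm => hom_ext fun i x => funext fun s =>
      congrArg (fun t => Hom.app t i x) (hm s))

instance : HasFiniteProducts (GrMod 𝒜) where
  out n := { has_limit := fun F =>
    have : HasProduct (fun s : Fin n => F.obj ⟨s⟩) := ⟨⟨⟨_, piFanIsLimit _⟩⟩⟩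
    have : HasLimit (Discrete.functor (F.obj ∘ Discrete.mk)) := this
    hasLimit_of_iso (Discrete.natIsoFunctor (F := F)).symm }

/-- The category of graded modules is abelian (kernels, cokernels and finite products being
computed degree by degree). -/
instance : Abelian (GrMod 𝒜) where

lemma act_congr (M : GrMod 𝒜) {i i' : ℕ} (hi : i = i') {j l : ℤ} (h : (i : ℤ) + j = l)
    (h' : (i' : ℤ) + j = l) (x : Λ) (hx : x ∈ 𝒜 i) (hx' : x ∈ 𝒜 i') (m : M.X j) :
    M.act i j l h ⟨x, hx⟩ m = M.act i' j l h' ⟨x, hx'⟩ m := by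
  subst hi; rfl

/-- The graded shift `M⟨j⟩`, with `(M⟨j⟩)_i = M_{i-j}`. -/
def shift (M : GrMod 𝒜) (j : ℤ) : GrMod 𝒜 where
  X i := M.X (i - j)
  act i s l h := M.act i (s - j) (l - j) (by omega)
  one_act s h m := M.one_act (s - j) (by omega) m
  mul_act i i' s s' l h h' h'' a b m :=
    M.mul_act i i' (s - j) (s' - j) (l - j) (by omega) (by omega) (by omega) a b m

/-- `M` is concentrated in degree `0`. -/
def ConcentratedInDegreeZero (M : GrMod 𝒜) : Prop := ∀ i : ℤ, i ≠ 0 → Subsingleton (M.X i)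

/-- `M` is finitely generated: there are finitely many homogeneous elements such that the only
graded submodule of `M` containing them is `M` itself. -/
def IsFinitelyGenerated (M : GrMod 𝒜) : Prop :=
  ∃ (n : ℕ) (d : Fin n → ℤ) (g : ∀ s, M.X (d s)),
    ∀ N : ∀ i : ℤ, Submodule k (M.X i),
      (∀ (i : ℕ) (j l : ℤ) (h : (i : ℤ) + j = l) (a : 𝒜 i) (m : M.X j),
        m ∈ N j → M.act i j l h a m ∈ N l) →
      (∀ s, g s ∈ N (d s)) → ∀ i, N i = ⊤

/-- The degree `0` part `M_0` as a module over the ring `Λ_0`. -/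
def degreeZero (M : GrMod 𝒜) : ModuleCat.{u} (𝒜 0) :=
  letI : Module (𝒜 0) (M.X 0) :=
    { smul := fun a m => M.act 0 0 0 (by simp) a m
      one_smul := fun m => M.one_act 0 (by simp) m
      mul_smul := fun a b m => M.mul_act 0 0 0 0 0 (by simp) (by simp) (by simp) a b m
      smul_zero := fun a => map_zero _
      smul_add := fun a => map_add _
      add_smul := fun a b m => by
        change M.act 0 0 0 _ (a + b) m = _
        rw [map_add]; rfl
      zero_smul := fun m => by
        change M.act 0 0 0 _ (0 : 𝒜 0) m = _
        rw [map_zero]; rfl }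
  ModuleCat.of (𝒜 0) (M.X 0)

end GrMod

/-- The grading of the opposite algebra: `(Λᵒᵖ)_i = Λ_i`. -/
def opGrading (𝒜 : ℕ → Submodule k Λ) (i : ℕ) : Submodule k Λᵐᵒᵖ :=
  (𝒜 i).comap (MulOpposite.opLinearEquiv k).symm.toLinearMap

variable (𝒜 : ℕ → Submodule k Λ) [GradedAlgebra 𝒜]

/-- The opposite algebra is graded. -/
noncomputable instance : GradedAlgebra (opGrading 𝒜) where
  one_mem := show (1 : Λ) ∈ 𝒜 0 from SetLike.GradedOne.one_mem
  mul_mem i j a b ha hb := by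
    have h := SetLike.mul_mem_graded (A := 𝒜) (i := j) (j := i) hb ha
    rw [add_comm] at h
    exact h
  toDecomposition := DirectSum.Decomposition.ofLinearMap _
    ((DirectSum.lmap (R := k) fun i =>
        (⟨⟨fun a => ⟨MulOpposite.op a.1, a.2⟩, fun _ _ => rfl⟩, fun _ _ => rfl⟩ :
          𝒜 i →ₗ[k] opGrading 𝒜 i)) ∘ₗ
      (DirectSum.decomposeLinearEquiv 𝒜).toLinearMap ∘ₗ
      (MulOpposite.opLinearEquiv k).symm.toLinearMap)
    (by
      apply LinearMap.ext
      intro x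
      obtain ⟨x, rfl⟩ := MulOpposite.op_surjective x
      induction x using DirectSum.Decomposition.inductionOn 𝒜 with
      | zero => simp
      | homogeneous m => simp [DirectSum.decomposeLinearEquiv, DirectSum.lmap_of]
      | add m n hm hn => rw [MulOpposite.op_add, map_add, hm, hn, map_add])
    (by
      ext i ⟨x, hx⟩ : 2
      obtain ⟨x, rfl⟩ := MulOpposite.op_surjective x
      have hx' : x ∈ 𝒜 i := hx
      have e : DirectSum.decomposeLinearEquiv 𝒜 x = DirectSum.lof k ℕ (fun i => 𝒜 i) i ⟨x, hx'⟩ :=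
        DirectSum.decompose_of_mem 𝒜 hx'
      simp only [LinearMap.comp_apply, DirectSum.coeLinearMap_lof, LinearEquiv.coe_coe,
        MulOpposite.coe_opLinearEquiv_symm, MulOpposite.unop_op, e, LinearMap.id_apply]
      exact DirectSum.lmap_lof _ _ _)

/-- The graded dual `DM` of a graded `Λ`-module `M`, a graded `Λᵒᵖ`-module:
`(DM)_i = Hom_k(M_{-i}, k)`, and `(λ f)(m) = f(λ m)`. -/
def GrMod.dual {𝒜 : ℕ → Submodule k Λ} [GradedAlgebra 𝒜] (M : GrMod 𝒜) :
    GrMod (opGrading 𝒜) where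
  X i := Module.Dual k (M.X (-i))
  act i j l h := LinearMap.mk₂ k
    (fun a f => f ∘ₗ M.act i (-l) (-j) (by omega) ⟨MulOpposite.unop a.1, a.2⟩)
    (fun a b f => by
      rw [← LinearMap.comp_add, ← map_add]; rfl)
    (fun c a f => by
      rw [← LinearMap.comp_smul, ← map_smul]; rfl)
    (fun a f g => rfl) (fun c a f => rfl)
  one_act j h f := by
    ext m
    exact congrArg f (M.one_act (-j) (by simp) m)
  mul_act i i' j j' l h h' h'' a b f := by
    ext m
    refine congrArg f (Eq.trans ?_ (M.mul_act i' i (-l) (-j') (-j) (by omega) (by omega)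
      (by omega) ⟨_, b.2⟩ ⟨_, a.2⟩ m))
    exact M.act_congr (add_comm i i') _ _ _ _ _ _

end GradedModules

/-! ## Homological notions -/

section Homological

/-- `Ext^i(X, Y) = 0` in an abelian category. -/
def ExtVanishes {C : Type v} [Category.{w} C] [Abelian C] (X Y : C) (i : ℕ) : Prop :=
  letI := HasExt.standard C
  Subsingleton (Abelian.Ext.{max v w} X Y i)

/-- `X` is basic: no indecomposable object occurs twice in a direct sum decomposition of `X`,
i.e. the indecomposable direct summands of `X` are pairwise non-isomorphic. -/
def IsBasicObject {C : Type v} [Category.{w} C] [Abelian C] (X : C) : Prop :=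
  ∀ Y Z W : C, Indecomposable Y → Indecomposable Z → Nonempty (X ≅ (Y ⊞ Z) ⊞ W) →
    IsEmpty (Y ≅ Z)

/-- The (left) global dimension of the ring `A` is finite. -/
def FiniteGlobalDimension (A : Type u) [Ring A] : Prop :=
  ∃ n : ℕ, ∀ M : ModuleCat.{u} A, HasProjectiveDimensionLE M n

/-- `M` belongs to `add T`: it is a direct summand of a finite direct sum of copies of `T`. -/
def InAdd {A : Type u} [Ring A] (T M : ModuleCat.{u} A) : Prop :=
  ∃ (n : ℕ) (N : ModuleCat.{u} A), Nonempty ((M × N) ≃ₗ[A] (Fin n → T))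

/-- Basic tilting modules. -/
structure IsTiltingModule {A : Type u} [Ring A] (T : ModuleCat.{u} A) : Prop where
  finite : Module.Finite A T
  basic : IsBasicObject T
  finite_projectiveDimension : ∃ n : ℕ, HasProjectiveDimensionLE T n
  ext_self : ∀ i : ℕ, 0 < i → ExtVanishes T T i
  /-- there is an exact sequence `0 → A → T_0 → T_1 → ⋯ → T_n → 0` with all `T_i` in `add T`
  (continued by `T_i = 0` for `i > n`) -/
  coresolution : ∃ (n : ℕ) (S : ℕ → ModuleCat.{u} A) (ε : A →ₗ[A] S 0)
    (d : ∀ i, S i →ₗ[A] S (i + 1)),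
    (∀ i, i ≤ n → InAdd T (S i)) ∧ (∀ i, n < i → Subsingleton (S i)) ∧
    Function.Injective ε ∧ Function.Exact ε (d 0) ∧
    ∀ i, Function.Exact (d i) (d (i + 1))

end Homological

/-! ## Koszul algebras with respect to a module -/

section Koszul

variable {k : Type u} [Field k] {Λ : Type u} [Ring Λ] [Algebra k Λ]

/-- The finiteness conditions on `Λ`: it is locally finite dimensional, and `Λ_0` is augmented
over `k^r` for some `r > 0`, i.e. there are algebra maps `k^r → Λ_0 → k^r` with composite the
identity such that the kernel of the second one is nil (hence is the radical of `Λ_0`; in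
particular `Λ_0` is a basic algebra). -/
structure IsLocallyFiniteAugmented (𝒜 : ℕ → Submodule k Λ) [GradedAlgebra 𝒜] : Prop where
  finite : ∀ i, Module.Finite k (𝒜 i)
  augmented : ∃ (r : ℕ) (_ : 0 < r) (σ : (Fin r → k) →ₐ[k] 𝒜 0) (ε : 𝒜 0 →ₐ[k] (Fin r → k)),
    (∀ x, ε (σ x) = x) ∧ ∀ a, ε a = 0 → IsNilpotent a

variable {𝒜 : ℕ → Submodule k Λ} [GradedAlgebra 𝒜]

/-- Graded self-orthogonal modules: `Ext^i_{Gr Λ}(T, T⟨j⟩) = 0` whenever `i ≠ j`. -/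
structure IsGradedSelfOrthogonal (T : GrMod 𝒜) : Prop where
  concentrated : T.ConcentratedInDegreeZero
  finitelyGenerated : T.IsFinitelyGenerated
  basic : IsBasicObject T
  ext_shift : ∀ (i : ℕ) (j : ℤ), (i : ℤ) ≠ j → ExtVanishes T (T.shift j) i

variable (𝒜) in
/-- `Λ` (with its grading `𝒜`) is Koszul with respect to the graded module `T`, which is
concentrated in degree `0`: it is a tilting module over `Λ_0` and graded self-orthogonal over `Λ`.
(The notion is used only when `Λ_0` has finite global dimension.) -/
structure IsKoszulWithRespectTo (T : GrMod 𝒜) : Prop where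
  concentrated : T.ConcentratedInDegreeZero
  tilting : IsTiltingModule T.degreeZero
  selfOrthogonal : IsGradedSelfOrthogonal T

end Koszul

/-! Everything rests on `k`-duality. Between `Λ`-modules and `Λᵒᵖ`-modules there are exact
contravariant functors `D` and `D'`, adjoint on the right: maps `X ⟶ D Z` correspond to maps `Z ⟶ D'
X`. They are not inverse equivalences, since a module of infinite dimension only embeds in its
double dual. Still, `D'` sends a projective resolution of `X` to an injective resolution of `D' X`,
so `Ext^i(X, D Z)` vanishes exactly when `Ext^i(Z, D' X)` does (`ExactDuality.extVanishes_iff`). The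
formalism is used twice, for graded modules and for modules over `Λ_0`.

Self-orthogonality: `T` is finite dimensional in each degree, so for the duality twisted by `⟨j⟩`
one has `D'(DT) ≅ T⟨j⟩`, and `Ext^i(DT, DT⟨j⟩)` is compared with `Ext^i(T, T⟨j⟩)`. Basicness
transfers because every summand of `DT` is reflexive (`isBasicObject_obj`).

Global dimension: a filtration by powers of the radical reduces the second argument of `Ext` to a
semisimple module. Such a module is a direct summand of its double dual, and the comparison of `Ext`
applies to that (`FiniteGlobalDimension.of_antiEquiv`).

Tilting: the difficulty is the coresolution of `Λ_0ᵒᵖ` by `add DT`. Dually, the injective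
`Λ_0`-module `D(Λ_0ᵒᵖ)` has to be resolved by `add T`. A module right orthogonal to `T` has a
surjective `add T`-approximation whose kernel is again right orthogonal to `T`
(`exists_rightApproximation`). Finite global dimension forces the iteration to stop at a split
approximation (`hasAddCoresolution_kdual`). -/

/-! ### Vanishing of `Ext` and long exact sequences -/

section ExtVanishing

variable {C : Type v} [Category.{w} C] [Abelian C]

lemma extVanishes_iff {X Y : C} {i : ℕ} :
    ExtVanishes X Y i ↔ letI := HasExt.standard C
      ∀ e : Abelian.Ext.{max v w} X Y i, e = 0 :=
  ⟨fun h _ => h.elim _ _, fun h => ⟨fun a b => (h a).trans (h b).symm⟩⟩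

namespace ExtVanishes

lemma of_retract_left {X X' Y : C} {i : ℕ} (r : Retract X' X) (h : ExtVanishes X Y i) :
    ExtVanishes X' Y i := by
  let := HasExt.standard C
  rw [extVanishes_iff] at h ⊢
  intro e
  rw [← e.mk₀_id_comp, ← r.retract, ← Abelian.Ext.mk₀_comp_mk₀,
    Abelian.Ext.comp_assoc_of_second_deg_zero, h (.comp _ _ _), Abelian.Ext.comp_zero]

lemma of_retract_right {X Y Y' : C} {i : ℕ} (r : Retract Y' Y) (h : ExtVanishes X Y i) :
    ExtVanishes X Y' i := by
  let := HasExt.standard C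
  rw [extVanishes_iff] at h ⊢
  intro e
  rw [← e.comp_mk₀_id, ← r.retract, ← Abelian.Ext.mk₀_comp_mk₀,
    ← Abelian.Ext.comp_assoc_of_second_deg_zero, h (.comp _ _ _), Abelian.Ext.zero_comp]

lemma of_projective {P Y : C} [Projective P] (i : ℕ) : ExtVanishes P Y (i + 1) := by
  let := HasExt.standard C
  exact extVanishes_iff.2 fun e => e.eq_zero_of_projective

lemma of_injective {X I : C} [Injective I] (i : ℕ) : ExtVanishes X I (i + 1) := by
  let := HasExt.standard C
  exact extVanishes_iff.2 fun e => e.eq_zero_of_injective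

lemma of_hasProjectiveDimensionLE {X Y : C} {n i : ℕ} (h : HasProjectiveDimensionLE X n)
    (hi : n < i) : ExtVanishes X Y i := by
  exact h.subsingleton' i hi (Y := Y)

lemma zero_iff {X Y : C} : ExtVanishes X Y 0 ↔ ∀ f : X ⟶ Y, f = 0 := by
  let := HasExt.standard C
  rw [extVanishes_iff]
  constructor
  · intro h f
    exact Abelian.Ext.mk₀_eq_zero_iff f |>.1 (h _)
  · intro h e
    rw [← Abelian.Ext.mk₀_homEquiv₀_apply e, h (Abelian.Ext.homEquiv₀ e), Abelian.Ext.mk₀_zero]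

variable {S : ShortComplex C} (hS : S.ShortExact)
include hS

/-- This and the next four statements are exactness of a long exact sequence of `Ext` at a term
whose two neighbours vanish. -/
lemma contravariant₃ {Y : C} {i : ℕ} (h₁ : ExtVanishes S.X₁ Y i)
    (h₂ : ExtVanishes S.X₂ Y (i + 1)) : ExtVanishes S.X₃ Y (i + 1) := by
  let := HasExt.standard C
  rw [extVanishes_iff] at *
  intro e
  obtain ⟨x, rfl⟩ := Abelian.Ext.contravariant_sequence_exact₃ hS Y e (h₂ _) (add_comm 1 i)
  rw [h₁ x, Abelian.Ext.comp_zero]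

lemma contravariant₁ {Y : C} {i : ℕ} (h₂ : ExtVanishes S.X₂ Y i)
    (h₃ : ExtVanishes S.X₃ Y (i + 1)) : ExtVanishes S.X₁ Y i := by
  let := HasExt.standard C
  rw [extVanishes_iff] at *
  intro e
  obtain ⟨x, rfl⟩ := Abelian.Ext.contravariant_sequence_exact₁ hS Y e (add_comm 1 i) (h₃ _)
  rw [h₂ x, Abelian.Ext.comp_zero]

lemma covariant₂ {X : C} {i : ℕ} (h₁ : ExtVanishes X S.X₁ i) (h₃ : ExtVanishes X S.X₃ i) :
    ExtVanishes X S.X₂ i := by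
  let := HasExt.standard C
  rw [extVanishes_iff] at *
  intro e
  obtain ⟨x, rfl⟩ := Abelian.Ext.covariant_sequence_exact₂ X hS e (h₃ _)
  rw [h₁ x, Abelian.Ext.zero_comp]

lemma covariant₁ {X : C} {i : ℕ} (h₃ : ExtVanishes X S.X₃ i)
    (h₂ : ExtVanishes X S.X₂ (i + 1)) : ExtVanishes X S.X₁ (i + 1) := by
  let := HasExt.standard C
  rw [extVanishes_iff] at *
  intro e
  obtain ⟨x, rfl⟩ := Abelian.Ext.covariant_sequence_exact₁ X hS e (h₂ _) rfl
  rw [h₃ x, Abelian.Ext.zero_comp]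

lemma covariant₃ {X : C} {i : ℕ} (h₂ : ExtVanishes X S.X₂ i)
    (h₁ : ExtVanishes X S.X₁ (i + 1)) : ExtVanishes X S.X₃ i := by
  let := HasExt.standard C
  rw [extVanishes_iff] at *
  intro e
  obtain ⟨x, rfl⟩ := Abelian.Ext.covariant_sequence_exact₃ X hS e rfl (h₁ _)
  rw [h₂ x, Abelian.Ext.zero_comp]

lemma exists_extension {Y : C} (h : ExtVanishes S.X₃ Y 1) (f : S.X₁ ⟶ Y) :
    ∃ g : S.X₂ ⟶ Y, S.f ≫ g = f := by
  let := HasExt.standard C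
  rw [extVanishes_iff] at h
  obtain ⟨x, hx⟩ := Abelian.Ext.contravariant_sequence_exact₁ hS Y (Abelian.Ext.mk₀ f)
    (add_zero 1) (h _)
  obtain ⟨g, rfl⟩ := Abelian.Ext.homEquiv₀.symm.surjective x
  exact ⟨g, Abelian.Ext.homEquiv₀.symm.injective (by simpa using hx)⟩

/-- The connecting map from `Hom(X₁, Y)` is onto because `Ext¹(X₂, Y)` vanishes, and it kills every
map that extends to `X₂`. `of_exists_lift` is the dual argument. -/
lemma of_exists_extension {Y : C} (h₂ : ExtVanishes S.X₂ Y 1)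
    (h : ∀ f : S.X₁ ⟶ Y, ∃ g : S.X₂ ⟶ Y, S.f ≫ g = f) : ExtVanishes S.X₃ Y 1 := by
  let := HasExt.standard C
  rw [extVanishes_iff] at *
  intro e
  obtain ⟨x, rfl⟩ := Abelian.Ext.contravariant_sequence_exact₃ hS Y e (h₂ _) (add_zero 1)
  obtain ⟨f, rfl⟩ := Abelian.Ext.homEquiv₀.symm.surjective x
  obtain ⟨g, rfl⟩ := h f
  rw [Abelian.Ext.homEquiv₀_symm_apply, ← Abelian.Ext.mk₀_comp_mk₀,
    hS.extClass_comp_assoc]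

lemma exists_lift {X : C} (h : ExtVanishes X S.X₁ 1) (f : X ⟶ S.X₃) :
    ∃ g : X ⟶ S.X₂, g ≫ S.g = f := by
  let := HasExt.standard C
  rw [extVanishes_iff] at h
  obtain ⟨x, hx⟩ := Abelian.Ext.covariant_sequence_exact₃ X hS (Abelian.Ext.mk₀ f)
    (zero_add 1) (h _)
  obtain ⟨g, rfl⟩ := Abelian.Ext.homEquiv₀.symm.surjective x
  exact ⟨g, Abelian.Ext.homEquiv₀.symm.injective (by simpa using hx)⟩

lemma of_exists_lift {X : C} (h₂ : ExtVanishes X S.X₂ 1)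
    (h : ∀ f : X ⟶ S.X₃, ∃ g : X ⟶ S.X₂, g ≫ S.g = f) : ExtVanishes X S.X₁ 1 := by
  let := HasExt.standard C
  rw [extVanishes_iff] at *
  intro e
  obtain ⟨x, rfl⟩ := Abelian.Ext.covariant_sequence_exact₁ X hS e (h₂ _) (zero_add 1)
  obtain ⟨f, rfl⟩ := Abelian.Ext.homEquiv₀.symm.surjective x
  obtain ⟨g, rfl⟩ := h f
  rw [Abelian.Ext.homEquiv₀_symm_apply, ← Abelian.Ext.mk₀_comp_mk₀,
    Abelian.Ext.comp_assoc_of_second_deg_zero, hS.comp_extClass, Abelian.Ext.comp_zero]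

end ExtVanishes

end ExtVanishing

/-! ### Abstract exact dualities -/

section Duality

universe v₁ v₂ u₁ u₂

/-- A pair of exact contravariant functors between abelian categories, adjoint on the right. -/
structure ExactDuality (C : Type u₁) [Category.{v₁} C] [Abelian C]
    (E : Type u₂) [Category.{v₂} E] [Abelian E] where
  D : Cᵒᵖ ⥤ E
  D' : Eᵒᵖ ⥤ C
  adj : D'.rightOp ⊣ D
  [additive : D.Additive]
  [additive' : D'.Additive]
  epi_map : ∀ {X Y : C} (f : X ⟶ Y) [Mono f], Epi (D.map f.op)
  shortExact' : ∀ {S : ShortComplex E}, S.ShortExact → (S.op.map D').ShortExact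
  mono_unit : ∀ X : E, Mono (adj.unit.app X)
  mono_counit : ∀ Z : C, Mono (adj.counit.app (Opposite.op Z)).unop

namespace ExactDuality

open Opposite

attribute [instance] additive additive' mono_unit mono_counit

variable {C : Type u₁} [Category.{v₁} C] [Abelian C] {E : Type u₂} [Category.{v₂} E] [Abelian E]
  (𝔻 : ExactDuality C E)

/-- Maps `X ⟶ D Z` correspond to maps `Z ⟶ D' X`. -/
def transpose (X : E) (Z : C) : (X ⟶ 𝔻.D.obj (op Z)) ≃ (Z ⟶ 𝔻.D'.obj (op X)) :=
  (𝔻.adj.homEquiv X (op Z)).symm.trans (opEquiv _ _)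

lemma transpose_comp_left {X X' : E} {Z : C} (f : X' ⟶ X) (g : X ⟶ 𝔻.D.obj (op Z)) :
    𝔻.transpose X' Z (f ≫ g) = 𝔻.transpose X Z g ≫ 𝔻.D'.map f.op :=
  congrArg Quiver.Hom.unop (𝔻.adj.homEquiv_naturality_left_symm f g)

lemma transpose_comp_right {X : E} {Z Z' : C} (f : Z' ⟶ Z) (g : X ⟶ 𝔻.D.obj (op Z)) :
    𝔻.transpose X Z' (g ≫ 𝔻.D.map f.op) = f ≫ 𝔻.transpose X Z g :=
  congrArg Quiver.Hom.unop (𝔻.adj.homEquiv_naturality_right_symm g f.op)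

/-- Transposition turns extending a map to `D' P` along a mono `f` into lifting a map from `P` along
`D f`, which is an epi. -/
lemma injective_of_projective (P : E) [Projective P] : Injective (𝔻.D'.obj (op P)) where
  factors {Z Z'} g f _ := by
    have := 𝔻.epi_map f
    refine ⟨𝔻.transpose _ _ (Projective.factorThru ((𝔻.transpose _ _).symm g)
      (𝔻.D.map f.op)), ?_⟩
    rw [← transpose_comp_right, Projective.factorThru_comp, Equiv.apply_symm_apply]

/-- Dimension shifting along `0 → K → P → X → 0` with `P` projective, whose image under `D'` is `0 →
D'X → D'P → D'K → 0` with `D'P` injective. Only `X` changes in the induction, so `Z` needs no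
resolution. -/
lemma extVanishes_iff [EnoughProjectives E] (X : E) (Z : C) (i : ℕ) :
    ExtVanishes X (𝔻.D.obj (op Z)) i ↔ ExtVanishes Z (𝔻.D'.obj (op X)) i := by
  induction i generalizing X with
  | zero =>
    rw [ExtVanishes.zero_iff, ExtVanishes.zero_iff]
    have h0 : 𝔻.transpose X Z 0 = 0 := by
      have := 𝔻.transpose_comp_left (0 : X ⟶ X) (0 : X ⟶ 𝔻.D.obj (op Z))
      rwa [zero_comp, op_zero, Functor.map_zero, comp_zero] at this
    constructor
    · intro h f
      rw [← (𝔻.transpose X Z).apply_symm_apply f, h (Equiv.symm _ f), h0]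
    · intro h f
      rw [← (𝔻.transpose X Z).injective.eq_iff, h (𝔻.transpose X Z f), h0]
  | succ i ih =>
    let π := Projective.π X
    let S : ShortComplex E := ShortComplex.mk (kernel.ι π) π (kernel.condition π)
    have hS : S.ShortExact := { exact := ShortComplex.exact_kernel π }
    have hS' := 𝔻.shortExact' hS
    have hP : Projective S.X₂ := inferInstanceAs (Projective (Projective.over X))
    have hI := 𝔻.injective_of_projective S.X₂
    have hI' : ∀ j, ExtVanishes Z (S.op.map 𝔻.D').X₂ (j + 1) := fun j =>
      @ExtVanishes.of_injective _ _ _ Z _ hI j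
    have hP' : ∀ j, ExtVanishes S.X₂ (𝔻.D.obj (op Z)) (j + 1) := fun j =>
      ExtVanishes.of_projective j
    -- `Ext¹` is a cokernel of `Hom` groups, so the inductive hypothesis in degree `0` does not
    -- help: extensions of maps `K ⟶ D Z` to `P` are matched directly with lifts of maps `Z ⟶ D' K`
    -- to `D' P`. From `Ext²` on, the shift is an honest reduction to `K`.
    obtain _ | i := i
    · constructor
      · intro h
        refine ExtVanishes.of_exists_lift hS' (hI' 0) fun f => ?_
        obtain ⟨g, hg⟩ := ExtVanishes.exists_extension hS h ((𝔻.transpose _ _).symm f)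
        refine ⟨𝔻.transpose _ _ g, (𝔻.transpose_comp_left S.f g).symm.trans ?_⟩
        rw [hg]
        exact Equiv.apply_symm_apply _ _
      · intro h
        refine ExtVanishes.of_exists_extension hS (hP' 0) fun f => ?_
        obtain ⟨g, hg⟩ := ExtVanishes.exists_lift hS' h (𝔻.transpose _ _ f)
        refine ⟨(𝔻.transpose _ _).symm g, (𝔻.transpose _ _).injective ?_⟩
        rw [transpose_comp_left]
        refine Eq.trans ?_ hg
        exact congrArg (· ≫ 𝔻.D'.map S.f.op) (Equiv.apply_symm_apply _ _)
    · constructor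
      · intro h
        exact ExtVanishes.covariant₁ hS' ((ih S.X₁).1
          (ExtVanishes.contravariant₁ hS (hP' i) h)) (hI' _)
      · intro h
        exact ExtVanishes.contravariant₃ hS ((ih S.X₁).2
          (ExtVanishes.covariant₃ hS' (hI' i) h)) (hP' _)

lemma isZero_of_isZero' {X : E} (h : IsZero (𝔻.D'.obj (op X))) : IsZero X :=
  IsZero.of_mono (𝔻.adj.unit.app X) (𝔻.D.map_isZero h.op)

lemma isZero_of_isZero {Z : C} (h : IsZero (𝔻.D.obj (op Z))) : IsZero Z :=
  IsZero.of_mono (𝔻.adj.counit.app (op Z)).unop (𝔻.D'.map_isZero h.op)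

/-- `D'` turns biproducts into biproducts. -/
noncomputable def mapBiprod' (X Y : E) :
    𝔻.D'.obj (op (X ⊞ Y)) ≅ 𝔻.D'.obj (op X) ⊞ 𝔻.D'.obj (op Y) where
  hom := biprod.lift (𝔻.D'.map biprod.inl.op) (𝔻.D'.map biprod.inr.op)
  inv := biprod.desc (𝔻.D'.map biprod.fst.op) (𝔻.D'.map biprod.snd.op)
  hom_inv_id := by
    rw [biprod.lift_desc, ← Functor.map_comp, ← Functor.map_comp, ← op_comp, ← op_comp,
      ← Functor.map_add, ← op_add, biprod.total, op_id, CategoryTheory.Functor.map_id]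
  inv_hom_id := by
    ext <;> simp [← Functor.map_comp, ← op_comp]

/-- `D` turns biproducts into biproducts. -/
noncomputable def mapBiprod (X Y : C) :
    𝔻.D.obj (op (X ⊞ Y)) ≅ 𝔻.D.obj (op X) ⊞ 𝔻.D.obj (op Y) where
  hom := biprod.lift (𝔻.D.map biprod.inl.op) (𝔻.D.map biprod.inr.op)
  inv := biprod.desc (𝔻.D.map biprod.fst.op) (𝔻.D.map biprod.snd.op)
  hom_inv_id := by
    rw [biprod.lift_desc, ← Functor.map_comp, ← Functor.map_comp, ← op_comp, ← op_comp,
      ← Functor.map_add, ← op_add, biprod.total, op_id, CategoryTheory.Functor.map_id]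
  inv_hom_id := by
    ext <;> simp [← Functor.map_comp, ← op_comp]

lemma isIso_unit_of_retract {X Y : E} (r : Retract Y X) [IsIso (𝔻.adj.unit.app X)] :
    IsIso (𝔻.adj.unit.app Y) :=
  (MorphismProperty.isomorphisms E).of_retract (NatTrans.retractArrowApp 𝔻.adj.unit r)
    ‹IsIso (𝔻.adj.unit.app X)›

/-- Applying `D` to a decomposition of `D' X` decomposes `X`, by reflexivity. A summand `P` with `D
P` zero is itself zero, since it embeds in `D' D P`. -/
lemma indecomposable_obj' {X : E} [IsIso (𝔻.adj.unit.app X)] (hX : Indecomposable X) :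
    Indecomposable (𝔻.D'.obj (op X)) := by
  refine ⟨fun h => hX.1 (𝔻.isZero_of_isZero' h), fun P Q e => ?_⟩
  have e' : X ≅ 𝔻.D.obj (op P) ⊞ 𝔻.D.obj (op Q) :=
    asIso (𝔻.adj.unit.app X) ≪≫ 𝔻.D.mapIso e.symm.op ≪≫ 𝔻.mapBiprod P Q
  exact (hX.2 _ _ e').imp 𝔻.isZero_of_isZero 𝔻.isZero_of_isZero

/-- By a triangle identity the unit at `D T` is a section of the isomorphism `D` applied to the
counit. -/
lemma isIso_unit_of_isIso_counit {T : C} [IsIso (𝔻.adj.counit.app (op T))] :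
    IsIso (𝔻.adj.unit.app (𝔻.D.obj (op T))) := by
  have : IsIso (𝔻.adj.unit.app (𝔻.D.obj (op T)) ≫ 𝔻.D.map (𝔻.adj.counit.app (op T))) := by
    rw [𝔻.adj.right_triangle_components]
    exact IsIso.id _
  exact IsIso.of_isIso_comp_right _ (𝔻.D.map (𝔻.adj.counit.app (op T)))

/-- `D'` carries a decomposition of `D T` to one of `D' D T ≅ T`. The indecomposable summands in
question are retracts of the reflexive object `D T`, hence reflexive, so their images stay
indecomposable; the remaining summand may be arbitrary. -/
lemma isBasicObject_obj {T : C} [IsIso (𝔻.adj.counit.app (op T))] (hT : IsBasicObject T) :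
    IsBasicObject (𝔻.D.obj (op T)) := by
  rintro Y Z W hY hZ ⟨e⟩
  refine ⟨fun f => ?_⟩
  have := 𝔻.isIso_unit_of_isIso_counit (T := T)
  have rY : Retract Y (𝔻.D.obj (op T)) :=
    { i := biprod.inl ≫ biprod.inl ≫ e.inv
      r := e.hom ≫ biprod.fst ≫ biprod.fst }
  have rZ : Retract Z (𝔻.D.obj (op T)) :=
    { i := biprod.inr ≫ biprod.inl ≫ e.inv
      r := e.hom ≫ biprod.fst ≫ biprod.snd }
  have := 𝔻.isIso_unit_of_retract rY
  have := 𝔻.isIso_unit_of_retract rZ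
  refine (hT _ _ (𝔻.D'.obj (op W)) (𝔻.indecomposable_obj' hY) (𝔻.indecomposable_obj' hZ)
    ⟨?_⟩).false (𝔻.D'.mapIso f.symm.op)
  exact (asIso (𝔻.adj.counit.app (op T))).unop ≪≫ 𝔻.D'.mapIso e.symm.op ≪≫
    𝔻.mapBiprod' _ _ ≪≫ biprod.mapIso (𝔻.mapBiprod' _ _) (Iso.refl _)

end ExactDuality

lemma IsBasicObject.of_iso {C : Type v} [Category.{w} C] [Abelian C] {X X' : C}
    (hX : IsBasicObject X) (e : X' ≅ X) : IsBasicObject X' :=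
  fun Y Z W hY hZ ⟨f⟩ => hX Y Z W hY hZ ⟨e.symm ≪≫ f⟩

end Duality

/-! ### Graded duality, twisted by a shift -/

section GradedDuality

open Opposite

variable {k : Type u} [Field k] {Λ : Type u} [Ring Λ] [Algebra k Λ]

lemma LinearMap.dualMap_exact {V₁ V₂ V₃ : Type*} [AddCommGroup V₁] [Module k V₁]
    [AddCommGroup V₂] [Module k V₂] [AddCommGroup V₃] [Module k V₃] {f : V₁ →ₗ[k] V₂}
    {g : V₂ →ₗ[k] V₃} (h : Function.Exact f g) : Function.Exact g.dualMap f.dualMap := by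
  rw [LinearMap.exact_iff] at h ⊢
  rw [LinearMap.range_dualMap_eq_dualAnnihilator_ker, LinearMap.ker_dualMap_eq_dualAnnihilator_range,
    h]

namespace GrMod

variable {𝒜 : ℕ → Submodule k Λ} [GradedAlgebra 𝒜]

lemma mono_of_injective {M N : GrMod 𝒜} (f : M ⟶ N) (h : ∀ i, Function.Injective (f.app i)) :
    Mono f where
  right_cancellation _ _ w := hom_ext fun i m => h i (congrArg (fun t => Hom.app t i m) w)

lemma epi_of_surjective {M N : GrMod 𝒜} (f : M ⟶ N) (h : ∀ i, Function.Surjective (f.app i)) :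
    Epi f where
  left_cancellation _ _ w := hom_ext fun i m => by
    obtain ⟨m, rfl⟩ := h i m
    exact congrArg (fun t => Hom.app t i m) w

lemma shortExact_of_exact {S : ShortComplex (GrMod 𝒜)}
    (hf : ∀ i, Function.Injective (S.f.app i)) (hg : ∀ i, Function.Surjective (S.g.app i))
    (h : ∀ i, Function.Exact (S.f.app i) (S.g.app i)) : S.ShortExact where
  exact := S.exact_of_f_is_kernel (isLimitOfExact S.f S.g S.zero hf fun i m hm => (h i m).1 hm)
  mono_f := mono_of_injective _ hf
  epi_g := epi_of_surjective _ hg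

lemma exact_of_shortExact {S : ShortComplex (GrMod 𝒜)} (hS : S.ShortExact) (i : ℤ) :
    Function.Exact (S.f.app i) (S.g.app i) := by
  intro m
  constructor
  · intro hm
    have h := hS.fIsKernel.fac (KernelFork.ofι (kerι S.g) (kerι_comp S.g)) WalkingParallelPair.zero
    exact ⟨_, congrArg (fun t : ker S.g ⟶ S.X₂ => Hom.app t i ⟨m, hm⟩) h⟩
  · rintro ⟨x, rfl⟩
    exact congrArg (fun t => Hom.app t i x) S.zero

/-- The identification of the homogeneous parts of equal degrees. -/
def castEquiv (M : GrMod 𝒜) {i j : ℤ} (h : i = j) : M.X i ≃ₗ[k] M.X j :=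
  h ▸ LinearEquiv.refl k (M.X i)

@[simp] lemma castEquiv_rfl (M : GrMod 𝒜) {i : ℤ} (h : i = i) (m : M.X i) :
    M.castEquiv h m = m := rfl

@[simp] lemma castEquiv_castEquiv (M : GrMod 𝒜) {i j l : ℤ} (h : i = j) (h' : j = l) (m : M.X i) :
    M.castEquiv h' (M.castEquiv h m) = M.castEquiv (h.trans h') m := by
  subst h h'; rfl

lemma act_castEquiv (M : GrMod 𝒜) {i : ℕ} {j j' l l' : ℤ} (hj : j = j') (hl : l = l')
    (h : (i : ℤ) + j = l) (h' : (i : ℤ) + j' = l') (a : 𝒜 i) (m : M.X j) :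
    M.act i j' l' h' a (M.castEquiv hj m) = M.castEquiv hl (M.act i j l h a m) := by
  subst hj hl; rfl

lemma app_castEquiv {M N : GrMod 𝒜} (f : M ⟶ N) {i j : ℤ} (h : i = j) (m : M.X i) :
    f.app j (M.castEquiv h m) = N.castEquiv h (f.app i m) := by
  subst h; rfl

/-- An isomorphism of graded modules from isomorphisms of the homogeneous parts. -/
def mkIso {M N : GrMod 𝒜} (e : ∀ i, M.X i ≃ₗ[k] N.X i)
    (comm : ∀ (i : ℕ) (j l : ℤ) (h : (i : ℤ) + j = l) (a : 𝒜 i) (m : M.X j),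
      e l (M.act i j l h a m) = N.act i j l h a (e j m)) : M ≅ N where
  hom := { app := fun i => e i, comm := comm }
  inv :=
    { app := fun i => (e i).symm
      comm := fun i j l h a m => (e l).injective (by simp [comm]) }
  hom_inv_id := hom_ext fun i m => (e i).symm_apply_apply m
  inv_hom_id := hom_ext fun i m => (e i).apply_symm_apply m

lemma isIso_of_bijective {M N : GrMod 𝒜} (f : M ⟶ N) (h : ∀ i, Function.Bijective (f.app i)) :
    IsIso f :=
  (mkIso (fun i => LinearEquiv.ofBijective (f.app i) (h i)) f.comm).isIso_hom

/-- `M⟨0⟩` is `M`. -/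
def shiftZero (M : GrMod 𝒜) : M.shift 0 ≅ M :=
  mkIso (fun i => M.castEquiv (sub_zero i)) fun _ _ _ _ _ _ => (M.act_castEquiv _ _ _ _ _ _).symm

/-- The graded `Λ`-module with `i`-th part `Hom_k(M_{j-i}, k)`, for a graded `Λᵒᵖ`-module `M`. -/
def predual (j : ℤ) (M : GrMod (opGrading 𝒜)) : GrMod 𝒜 where
  X i := Module.Dual k (M.X (j - i))
  act i s l h := LinearMap.mk₂ k
    (fun a f => f ∘ₗ M.act i (j - l) (j - s) (by omega) ⟨MulOpposite.op a.1, a.2⟩)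
    (fun a b f => by
      rw [← LinearMap.comp_add, ← map_add]; rfl)
    (fun c a f => by
      rw [← LinearMap.comp_smul, ← map_smul]; rfl)
    (fun a f g => rfl) (fun c a f => rfl)
  one_act s h f := by
    ext m
    exact congrArg f (M.one_act (j - s) (by simp) m)
  mul_act i i' s s' l h h' h'' a b f := by
    ext m
    refine congrArg f (Eq.trans ?_ (M.mul_act i' i (j - l) (j - s') (j - s) (by omega) (by omega)
      (by omega) ⟨MulOpposite.op b.1, b.2⟩ ⟨MulOpposite.op a.1, a.2⟩ m))
    exact M.act_congr (add_comm i i') _ _ _ _ _ _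

variable (𝒜) in
/-- The functor `Z ↦ (DZ)⟨j⟩`. -/
noncomputable def dualFunctor (j : ℤ) : (GrMod 𝒜)ᵒᵖ ⥤ GrMod (opGrading 𝒜) where
  obj Z := Z.unop.dual.shift j
  map {X Y} f :=
    { app := fun i => (f.unop.app (-(i - j))).dualMap
      comm := fun i s l h a φ => LinearMap.ext fun m => 
        congrArg (DFunLike.coe (F := Module.Dual k ((unop X).X (-(s - j)))) φ)
          (f.unop.comm i (-(l - j)) (-(s - j)) (by omega) ⟨a.1.unop, a.2⟩ m).symm }

variable (𝒜) in
/-- The functor `predual j`. -/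
noncomputable def predualFunctor (j : ℤ) : (GrMod (opGrading 𝒜))ᵒᵖ ⥤ GrMod 𝒜 where
  obj X := X.unop.predual j
  map {X Y} f :=
    { app := fun i => (f.unop.app (j - i)).dualMap
      comm := fun i s l h a φ => LinearMap.ext fun m => 
        congrArg (DFunLike.coe (F := Module.Dual k ((unop X).X (j - s))) φ)
          (f.unop.comm i (j - l) (j - s) (by omega) ⟨MulOpposite.op a.1, a.2⟩ m).symm }

/-- The evaluation map `X ⟶ D D' X`. -/
noncomputable def evalUnit (j : ℤ) (X : GrMod (opGrading 𝒜)) : X ⟶ (X.predual j).dual.shift j where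
  app i := Module.Dual.eval k _ ∘ₗ (X.castEquiv (show i = j - -(i - j) by omega)).toLinearMap
  comm i s l h a m := LinearMap.ext fun φ =>
    congrArg (DFunLike.coe (F := Module.Dual k (X.X (j - -(l - j)))) φ)
      (X.act_castEquiv (by omega) (by omega) h (by omega) a m).symm

/-- The evaluation map `Z ⟶ D' D Z`. -/
noncomputable def evalCounit (j : ℤ) (Z : GrMod 𝒜) : Z ⟶ (Z.dual.shift j).predual j where
  app i := Module.Dual.eval k _ ∘ₗ (Z.castEquiv (show i = -((j - i) - j) by omega)).toLinearMap
  comm i s l h a m := LinearMap.ext fun φ =>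
    congrArg (DFunLike.coe (F := Module.Dual k (Z.X (-((j - l) - j)))) φ)
      (Z.act_castEquiv (by omega) (by omega) h (by omega) a m).symm

lemma evalUnit_injective (j : ℤ) (X : GrMod (opGrading 𝒜)) (i : ℤ) :
    Function.Injective ((evalUnit j X).app i) :=
  (Module.eval_apply_injective k).comp (LinearEquiv.injective _)

lemma evalCounit_injective (j : ℤ) (Z : GrMod 𝒜) (i : ℤ) :
    Function.Injective ((evalCounit j Z).app i) :=
  (Module.eval_apply_injective k).comp (LinearEquiv.injective _)

lemma evalCounit_bijective (j : ℤ) (Z : GrMod 𝒜) (i : ℤ) [Module.Finite k (Z.X i)] :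
    Function.Bijective ((evalCounit j Z).app i) := by
  have : Module.Finite k (Z.X (-((j - i) - j))) :=
    Module.Finite.equiv (Z.castEquiv (show i = -((j - i) - j) by omega))
  exact (Module.bijective_dual_eval k _).comp (LinearEquiv.bijective _)

/-- A degree such as `j - (-(i - j))` is only propositionally equal to `i`, so evaluation maps
involve casts. This statement and the next move a cast from a functional to its argument, as the
triangle identities require. -/
lemma predual_castEquiv_apply (j : ℤ) (M : GrMod (opGrading 𝒜)) {i i' : ℤ} (h : i = i')
    (h' : j - i' = j - i) (φ : Module.Dual k (M.X (j - i))) (m : M.X (j - i')) :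
    DFunLike.coe (F := Module.Dual k (M.X (j - i'))) ((M.predual j).castEquiv h φ) m = φ (M.castEquiv h' m) := by
  subst h; rfl

lemma dual_shift_castEquiv_apply (j : ℤ) (M : GrMod 𝒜) {i i' : ℤ} (h : i = i')
    (h' : -(i' - j) = -(i - j)) (φ : Module.Dual k (M.X (-(i - j)))) (m : M.X (-(i' - j))) :
    DFunLike.coe (F := Module.Dual k (M.X (-(i' - j)))) ((M.dual.shift j).castEquiv h φ) m =
      φ (M.castEquiv h' m) := by
  subst h; rfl

variable (𝒜) in
/-- The duality between graded `Λ`-modules and graded `Λᵒᵖ`-modules, twisted by `⟨j⟩`. -/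
noncomputable def duality (j : ℤ) : ExactDuality (GrMod 𝒜) (GrMod (opGrading 𝒜)) where
  D := dualFunctor 𝒜 j
  D' := predualFunctor 𝒜 j
  adj :=
    { unit :=
        { app := fun X => evalUnit j X
          naturality := fun X Y f => hom_ext fun i m => LinearMap.ext fun φ =>
            congrArg
            (DFunLike.coe (F := Module.Dual k (Y.X (j - -(i - j)))) φ)
            (app_castEquiv f (by omega) m).symm }
      counit :=
        { app := fun Z => (evalCounit j Z.unop).op
          naturality := fun X Y f => Quiver.Hom.unop_inj (hom_ext fun i m => LinearMap.ext fun φ =>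
            congrArg
            (DFunLike.coe (F := Module.Dual k ((unop X).X (-((j - i) - j)))) φ)
            (app_castEquiv f.unop (by omega) m)) }
      left_triangle_components := fun X => Quiver.Hom.unop_inj (hom_ext fun i φ =>
        LinearMap.ext fun m => by
          refine (predual_castEquiv_apply j X (show i = -(j - i - j) by omega) (by omega) φ _).trans ?_
          exact congrArg (DFunLike.coe (F := Module.Dual k (X.X (j - i))) φ)
            ((X.castEquiv_castEquiv _ _ m).trans (X.castEquiv_rfl _ m)))
      right_triangle_components := fun Z => hom_ext fun i φ =>
        LinearMap.ext fun m => by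
          refine (dual_shift_castEquiv_apply j Z.unop (show i = j - -(i - j) by omega) (by omega) φ _).trans ?_
          exact congrArg (DFunLike.coe (F := Module.Dual k (Z.unop.X (-(i - j)))) φ)
            ((Z.unop.castEquiv_castEquiv _ _ m).trans (Z.unop.castEquiv_rfl _ m)) }
  additive := ⟨fun {_ _ f g} => hom_ext fun _ φ => LinearMap.ext fun m =>
    map_add (N := k) (show Module.Dual k _ from φ) (f.unop.app _ m) (g.unop.app _ m)⟩
  additive' := ⟨fun {_ _ f g} => hom_ext fun _ φ => LinearMap.ext fun m =>
    map_add (N := k) (show Module.Dual k _ from φ) (f.unop.app _ m) (g.unop.app _ m)⟩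
  epi_map f _ := epi_of_surjective _ fun i =>
    LinearMap.dualMap_surjective_of_injective (injective_of_mono f _)
  shortExact' {S} hS :=
    have := hS.mono_f
    have := hS.epi_g
    shortExact_of_exact
      (fun i => LinearMap.dualMap_injective_of_surjective (surjective_of_epi S.g _))
      (fun i => LinearMap.dualMap_surjective_of_injective (injective_of_mono S.f _))
      (fun i => LinearMap.dualMap_exact (exact_of_shortExact hS _))
  mono_unit X := mono_of_injective _ (evalUnit_injective j X)
  mono_counit Z := mono_of_injective _ (evalCounit_injective j Z)

end GrMod
end GradedDuality

/-! ### Enough projectives in the graded category -/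

section GradedProjectives

variable {k : Type u} [Field k] {Λ : Type u} [Ring Λ] [Algebra k Λ]

namespace GrMod

/-- The homogeneous part of integral degree `n` (zero for `n < 0`). -/
def intPart (𝒜 : ℕ → Submodule k Λ) : ℤ → Submodule k Λ
  | Int.ofNat i => 𝒜 i
  | Int.negSucc _ => ⊥

variable {𝒜 : ℕ → Submodule k Λ} [GradedAlgebra 𝒜]

lemma mul_mem_intPart {i : ℕ} {n m : ℤ} (h : (i : ℤ) + n = m) {a x : Λ} (ha : a ∈ 𝒜 i)
    (hx : x ∈ intPart 𝒜 n) : a * x ∈ intPart 𝒜 m := by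
  subst h
  obtain n | n := n
  · exact SetLike.mul_mem_graded (A := 𝒜) (j := n) ha hx
  · rw [(Submodule.mem_bot k).1 hx, mul_zero]
    exact zero_mem _

lemma one_mem_intPart {n : ℤ} (h : n = 0) : (1 : Λ) ∈ intPart 𝒜 n := by
  subst h
  exact SetLike.GradedOne.one_mem (A := 𝒜)

variable (𝒜) in
/-- The free graded module on a generator of degree `d`. -/
def free (d : ℤ) : GrMod 𝒜 where
  X i := intPart 𝒜 (i - d)
  act i j l h := LinearMap.mk₂ k
    (fun a x => ⟨a.1 * x.1, mul_mem_intPart (by omega) a.2 x.2⟩)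
    (fun a b m => Subtype.ext (add_mul _ _ _)) (fun c a m => Subtype.ext (smul_mul_assoc _ _ _))
    (fun a m n => Subtype.ext (mul_add _ _ _)) (fun c a m => Subtype.ext (mul_smul_comm _ _ _))
  one_act j h m := Subtype.ext (one_mul _)
  mul_act i i' j j' l h h' h'' a b m := Subtype.ext (mul_assoc _ _ _)

/-- The generator of the free module. -/
def gen (d : ℤ) : (free 𝒜 d).X d := ⟨1, one_mem_intPart (sub_self d)⟩

/-- The action of the homogeneous elements of integral degree. -/
def intAct (M : GrMod 𝒜) : ∀ (n j l : ℤ), n + j = l → (intPart 𝒜 n →ₗ[k] M.X j →ₗ[k] M.X l)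
  | Int.ofNat i, j, l, h => M.act i j l h
  | Int.negSucc _, _, _, _ => 0

lemma intAct_mul (M : GrMod 𝒜) {i : ℕ} {n n' j l l' : ℤ} (hn : (i : ℤ) + n = n') (hl : n + j = l)
    (hl' : (i : ℤ) + l = l') (h : n' + j = l') (a : 𝒜 i) (x : intPart 𝒜 n) (m : M.X j) :
    M.intAct n' j l' h ⟨a.1 * x.1, mul_mem_intPart hn a.2 x.2⟩ m =
      M.act i l l' hl' a (M.intAct n j l hl x m) := by
  subst hn
  obtain n | n := n
  · exact M.mul_act i n j l l' hl hl' h a x m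
  · have hx : x = 0 := Subtype.ext ((Submodule.mem_bot k).1 x.2)
    subst hx
    have : (⟨a.1 * (0 : intPart 𝒜 (Int.negSucc n)).1,
        mul_mem_intPart rfl a.2 (0 : intPart 𝒜 (Int.negSucc n)).2⟩ :
          intPart 𝒜 (i + Int.negSucc n)) = 0 := Subtype.ext (mul_zero _)
    rw [this]
    simp

lemma intAct_one (M : GrMod 𝒜) {n j : ℤ} (hn : n = 0) (h : n + j = j) (m : M.X j) :
    M.intAct n j j h ⟨1, one_mem_intPart hn⟩ m = m := by
  subst hn
  exact M.one_act j h m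

/-- The morphism from the free module sending the generator to `m`. -/
def freeDesc {M : GrMod 𝒜} {d : ℤ} (m : M.X d) : free 𝒜 d ⟶ M where
  app i := (M.intAct (i - d) d i (by omega)).flip m
  comm i j l h a x := M.intAct_mul (by omega) (by omega) h (by omega) a x m

@[simp] lemma freeDesc_gen {M : GrMod 𝒜} {d : ℤ} (m : M.X d) : (freeDesc m).app d (gen d) = m :=
  M.intAct_one (sub_self d) (by omega) m

lemma free_act_gen {d i : ℤ} {n : ℕ} (hn : (n : ℤ) = i - d) (x : (free 𝒜 d).X i) :
    ∃ a : 𝒜 n, (free 𝒜 d).act n d i (by omega) a (gen d) = x := by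
  obtain ⟨x, hx⟩ := x
  rw [← hn] at hx
  exact ⟨⟨x, hx⟩, Subtype.ext (mul_one _)⟩

/-- In degrees at least `d` every element is a multiple of the generator; in degrees below `d` the
free module is zero. -/
lemma free_hom_ext {M : GrMod 𝒜} {d : ℤ} {f g : free 𝒜 d ⟶ M}
    (h : f.app d (gen d) = g.app d (gen d)) : f = g := by
  refine hom_ext fun i x => ?_
  by_cases hi : d ≤ i
  · obtain ⟨n, hn⟩ := Int.eq_ofNat_of_zero_le (show 0 ≤ i - d by omega)
    obtain ⟨a, rfl⟩ := free_act_gen hn.symm x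
    rw [f.comm, g.comm, h]
  · obtain ⟨n, hn⟩ := Int.eq_negSucc_of_lt_zero (show i - d < 0 by omega)
    have hx : x = 0 := by
      obtain ⟨x, hx⟩ := x
      rw [hn] at hx
      exact Subtype.ext ((Submodule.mem_bot k).1 hx)
    rw [hx, map_zero, map_zero]

instance (d : ℤ) : Projective (free 𝒜 d) where
  factors {E X} f e _ := by
    obtain ⟨m, hm⟩ := surjective_of_epi e d (f.app d (gen d))
    exact ⟨freeDesc m, free_hom_ext (by rw [comp_app, freeDesc_gen, hm])⟩

open Classical in
/-- The direct sum of a family of graded modules, degree by degree. -/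
def directSum {J : Type u} (M : J → GrMod 𝒜) : GrMod 𝒜 where
  X i := Π₀ s, (M s).X i
  act i j l h := LinearMap.mk₂ k
    (fun a => DFinsupp.mapRange.linearMap fun s => (M s).act i j l h a)
    (fun a b m => by ext; simp) (fun c a m => by ext; simp)
    (fun a m n => by ext; simp) (fun c a m => by ext; simp)
  one_act j h m := DFinsupp.ext fun s => (M s).one_act j h (m s)
  mul_act i i' j j' l h h' h'' a b m :=
    DFinsupp.ext fun s => (M s).mul_act i i' j j' l h h' h'' a b (m s)

open Classical in
/-- The inclusions into the direct sum. -/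
noncomputable def directSumι {J : Type u} (M : J → GrMod 𝒜) (s : J) : M s ⟶ directSum M where
  app i :=
    { toFun := fun m => DFinsupp.single (β := fun s => (M s).X i) s m
      map_add' := fun x y => DFinsupp.single_add (β := fun s => (M s).X i) s x y
      map_smul' := fun _ _ => DFinsupp.single_smul (β := fun s => (M s).X i) _ _ }
  comm i j l h a _ := (DFinsupp.mapRange_single
    (f := fun s => (M s).act i j l h a) (hf := fun _ => map_zero _)).symm

open Classical in
/-- The universal property of the direct sum. -/
noncomputable def directSumDesc {J : Type u} {M : J → GrMod 𝒜} {N : GrMod 𝒜}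
    (f : ∀ s, M s ⟶ N) : directSum M ⟶ N where
  app i := DFinsupp.lsum ℕ fun s => (f s).app i
  comm i j l h a m := by
    have : (DFinsupp.lsum ℕ fun s => (f s).app l) ∘ₗ (directSum M).act i j l h a =
        N.act i j l h a ∘ₗ (DFinsupp.lsum ℕ fun s => (f s).app j) := by
      refine DFinsupp.lhom_ext fun s x => ?_
      have e := congrArg (DFinsupp.lsum ℕ fun s => (f s).app l)
        ((directSumι M s).comm i j l h a x).symm
      have e₁ : (DFinsupp.lsum ℕ fun s => (f s).app l)
          ((directSumι M s).app l ((M s).act i j l h a x)) = (f s).app l ((M s).act i j l h a x) :=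
        DFinsupp.lsum_single ℕ (M := fun s => (M s).X l) (fun s => (f s).app l) s _
      have e₂ : (DFinsupp.lsum ℕ fun s => (f s).app j) (DFinsupp.single s x) = (f s).app j x :=
        DFinsupp.lsum_single ℕ (M := fun s => (M s).X j) (fun s => (f s).app j) s _
      refine (e.trans (e₁.trans ((f s).comm i j l h a x))).trans ?_
      rw [LinearMap.comp_apply, e₂]
    exact congrArg (fun t => t m) this

open Classical in
lemma directSumι_desc {J : Type u} {M : J → GrMod 𝒜} {N : GrMod 𝒜} (f : ∀ s, M s ⟶ N) (s : J) :
    directSumι M s ≫ directSumDesc f = f s :=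
  hom_ext fun i m => by
    exact DFinsupp.lsum_single ℕ (M := fun s => (M s).X i) (fun s => (f s).app i) s m

open Classical in
lemma directSum_hom_ext {J : Type u} {M : J → GrMod 𝒜} {N : GrMod 𝒜} {f g : directSum M ⟶ N}
    (h : ∀ s, directSumι M s ≫ f = directSumι M s ≫ g) : f = g := by
  refine Hom.ext (funext fun i => DFinsupp.lhom_ext fun s x => ?_)
  exact congrArg (fun t => Hom.app t i x) (h s)

instance {J : Type u} (M : J → GrMod 𝒜) [∀ s, Projective (M s)] : Projective (directSum M) where
  factors f e _ := ⟨directSumDesc fun s => Projective.factorThru (directSumι M s ≫ f) e,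
    directSum_hom_ext fun s => by
      rw [← Category.assoc, directSumι_desc, Projective.factorThru_comp]⟩

/-- One free summand is taken for each homogeneous element, so each element is the image of a
generator. `ULift` puts the set of degrees in the universe required of the index type. -/
instance : EnoughProjectives (GrMod 𝒜) where
  presentation M := ⟨
    { p := directSum fun s : (Σ d : ULift.{u} ℤ, M.X d.down) => free 𝒜 s.1.down
      f := directSumDesc fun s => freeDesc s.2
      epi := ⟨fun a b h => hom_ext fun i m => by
        have := congrArg (fun t => directSumι (fun s : (Σ d : ULift.{u} ℤ, M.X d.down) => free 𝒜 s.1.down)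
          ⟨⟨i⟩, m⟩ ≫ t) h
        simp only [← Category.assoc, directSumι_desc] at this
        have := congrArg (fun t => Hom.app t i (gen i)) this
        simpa using this⟩ }⟩

end GrMod
end GradedProjectives

/-! ### Duality for ungraded modules over an algebra and its opposite -/

section ModuleDuality

open Opposite MulOpposite
open scoped ModuleCat

variable {k : Type u} [Field k] {A B : Type u} [Ring A] [Ring B] [Algebra k A] [Algebra k B]

/-- The `B`-module structure on the `k`-dual of an `A`-module given by an anti-homomorphism
from `B` to `A`. -/
@[reducible]
def dualModule (τ : B →ₐ[k] Aᵐᵒᵖ) (M : ModuleCat.{u} A) : Module B (Module.Dual k M) where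
  smul b φ := φ ∘ₗ Algebra.lsmul k k M (unop (τ b))
  one_smul φ := LinearMap.ext fun m => congrArg φ (by simp)
  mul_smul b b' φ := LinearMap.ext fun m => congrArg φ (by simp)
  smul_zero b := rfl
  smul_add b φ ψ := rfl
  add_smul b b' φ := LinearMap.ext fun m =>
    (congrArg φ (by simp)).trans (map_add φ (unop (τ b) • m) (unop (τ b') • m))
  zero_smul φ := LinearMap.ext fun m => (congrArg φ (by simp)).trans (map_zero φ)

namespace ModuleCat

/-- The `k`-dual of an `A`-module, as a `B`-module. -/
def kdual (τ : B →ₐ[k] Aᵐᵒᵖ) (M : ModuleCat.{u} A) : ModuleCat.{u} B :=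
  letI := dualModule τ M
  ModuleCat.of B (Module.Dual k M)

variable (τ : B →ₐ[k] Aᵐᵒᵖ) (σ : A →ₐ[k] Bᵐᵒᵖ)

instance (M : ModuleCat.{u} A) : FunLike (kdual τ M) M k :=
  inferInstanceAs (FunLike (Module.Dual k M) M k)

instance (M : ModuleCat.{u} A) : AddMonoidHomClass (kdual τ M) M k :=
  inferInstanceAs (AddMonoidHomClass (Module.Dual k M) M k)

variable {τ}

@[ext] lemma kdual_ext {M : ModuleCat.{u} A} {φ ψ : kdual τ M} (h : ∀ m, φ m = ψ m) : φ = ψ :=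
  LinearMap.ext h

@[simp] lemma kdual_zero_apply {M : ModuleCat.{u} A} (m : M) :
    (0 : kdual τ M) m = 0 := rfl

@[simp] lemma kdual_smul_apply {M : ModuleCat.{u} A} (b : B) (φ : kdual τ M) (m : M) :
    (b • φ) m = φ (unop (τ b) • m) := rfl

lemma kdual_map_smul {M : ModuleCat.{u} A} (φ : kdual τ M) (c : k) (m : M) :
    φ (c • m) = c * φ m := LinearMap.map_smul (show Module.Dual k M from φ) c m

-- On the left `k` acts through `B`. This agrees with the pointwise action on functionals because
-- `τ` is a map of `k`-algebras.
@[simp] lemma kdual_ksmul_apply {M : ModuleCat.{u} A} (c : k) (φ : kdual τ M) (m : M) :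
    (c • φ) m = c * φ m := by
  have h : c • φ = algebraMap k B c • φ := rfl
  rw [h, kdual_smul_apply, AlgHom.commutes, ← kdual_map_smul]
  rfl

variable (τ) in
/-- The transpose of a linear map. -/
def kdualMap {M N : ModuleCat.{u} A} (f : M ⟶ N) : kdual τ N ⟶ kdual τ M :=
  ModuleCat.ofHom (X := kdual τ N) (Y := kdual τ M)
    { toFun := fun φ => (show Module.Dual k N from φ) ∘ₗ f.hom.restrictScalars k
      map_add' := fun _ _ => rfl
      map_smul' := fun b φ => by
        ext m
        exact congrArg φ (f.hom.map_smul (unop (τ b)) m).symm }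

variable (τ) in
/-- The contravariant functor `Hom_k(-, k)`. -/
def kdualFunctor : (ModuleCat.{u} A)ᵒᵖ ⥤ ModuleCat.{u} B where
  obj M := kdual τ M.unop
  map f := kdualMap τ f.unop

lemma kdualMap_injective {M N : ModuleCat.{u} A} {f : M ⟶ N} (hf : Function.Surjective f.hom) :
    Function.Injective (kdualMap τ f).hom :=
  LinearMap.dualMap_injective_of_surjective (f := f.hom.restrictScalars k) hf

lemma kdualMap_surjective {M N : ModuleCat.{u} A} {f : M ⟶ N} (hf : Function.Injective f.hom) :
    Function.Surjective (kdualMap τ f).hom :=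
  LinearMap.dualMap_surjective_of_injective (f := f.hom.restrictScalars k) hf

lemma kdualMap_exact {M N P : ModuleCat.{u} A} {f : M ⟶ N} {g : N ⟶ P}
    (h : Function.Exact f.hom g.hom) :
    Function.Exact (kdualMap τ g).hom (kdualMap τ f).hom :=
  LinearMap.dualMap_exact (f := f.hom.restrictScalars k) (g := g.hom.restrictScalars k) h

variable (τ) {σ}

/-- Evaluation, as a map to the double dual. -/
def kdualEval (h : ∀ a, unop (τ (unop (σ a))) = a) (M : ModuleCat.{u} A) :
    M ⟶ kdual σ (kdual τ M) :=
  ModuleCat.ofHom (Y := kdual σ (kdual τ M))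
    { toFun := fun m => show Module.Dual k (kdual τ M) from
        { toFun := fun φ => φ m
          map_add' := fun _ _ => rfl
          map_smul' := fun c φ => kdual_ksmul_apply c φ m }
      map_add' := fun _ _ => kdual_ext fun φ => map_add φ _ _
      map_smul' := fun a _ => kdual_ext fun φ => congrArg (fun t => φ (t • _)) (h a).symm }

variable {τ}

lemma kdualEval_injective (h : ∀ a, unop (τ (unop (σ a))) = a) (M : ModuleCat.{u} A) :
    Function.Injective (kdualEval τ h M).hom := fun _ _ hmn =>
  Module.eval_apply_injective k (LinearMap.ext fun φ =>
    congrArg (fun ψ : kdual σ (kdual τ M) => ψ (show kdual τ M from φ)) hmn)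

lemma kdualEval_surjective (h : ∀ a, unop (τ (unop (σ a))) = a) (M : ModuleCat.{u} A)
    [Module.Finite k M] : Function.Surjective (kdualEval τ h M).hom := fun ψ => by
  obtain ⟨m, hm⟩ := (Module.bijective_dual_eval k M).2
    { toFun := fun φ => ψ (show kdual τ M from φ)
      map_add' := fun φ φ' => map_add ψ (show kdual τ M from φ) (show kdual τ M from φ')
      map_smul' := fun c φ => by
        refine Eq.trans (congrArg ψ ?_) (kdual_map_smul ψ c (show kdual τ M from φ))
        exact kdual_ext fun m => (kdual_ksmul_apply c (show kdual τ M from φ) m).symm }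
  exact ⟨m, kdual_ext fun φ => congrArg (fun t => t φ) hm⟩

lemma kdual_finite [Module.Finite k A] (M : ModuleCat.{u} A) [Module.Finite A M] :
    Module.Finite B (kdual τ M) := by
  have : Module.Finite k M := Module.Finite.trans A M
  have h : Module.Finite k (Module.Dual k M) := inferInstance
  let := dualModule τ M
  have : IsScalarTower k B (Module.Dual k M) := ⟨fun c b φ => LinearMap.ext fun m => by
    have := kdual_map_smul (τ := τ) φ c (unop (τ b) • m)
    refine Eq.trans (congrArg φ ?_) this
    simp⟩
  exact Module.Finite.of_restrictScalars_finite k B (Module.Dual k M)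

/-- The duality between `A`-modules and `B`-modules, where `B` is the opposite of `A`. -/
def duality (hτ : ∀ a, unop (τ (unop (σ a))) = a) (hσ : ∀ b, unop (σ (unop (τ b))) = b) :
    ExactDuality (ModuleCat.{u} A) (ModuleCat.{u} B) where
  D := kdualFunctor τ
  D' := kdualFunctor σ
  adj :=
    { unit :=
        { app := fun X => kdualEval σ hσ X
          naturality := fun _ _ _ => rfl }
      counit :=
        { app := fun Z => (kdualEval τ hτ Z.unop).op
          naturality := fun _ _ _ => rfl }
      left_triangle_components := fun _ => rfl
      right_triangle_components := fun _ => rfl }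
  additive := ⟨fun {_ _ f g} => ModuleCat.hom_ext (LinearMap.ext fun φ => kdual_ext fun m =>
    map_add (show kdual τ _ from φ) (f.unop.hom m) (g.unop.hom m))⟩
  additive' := ⟨fun {_ _ f g} => ModuleCat.hom_ext (LinearMap.ext fun φ => kdual_ext fun m =>
    map_add (show kdual σ _ from φ) (f.unop.hom m) (g.unop.hom m))⟩
  epi_map f _ := (ModuleCat.epi_iff_surjective _).2
    (kdualMap_surjective ((ModuleCat.mono_iff_injective f).1 inferInstance))
  shortExact' hS :=
    { exact := (ShortComplex.ShortExact.moduleCat_exact_iff_function_exact _).2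
        (kdualMap_exact ((ShortComplex.ShortExact.moduleCat_exact_iff_function_exact _).1 hS.exact))
      mono_f := (ModuleCat.mono_iff_injective _).2
        (kdualMap_injective hS.moduleCat_surjective_g)
      epi_g := (ModuleCat.epi_iff_surjective _).2
        (kdualMap_surjective hS.moduleCat_injective_f) }
  mono_unit X := (ModuleCat.mono_iff_injective _).2 (kdualEval_injective hσ X)
  mono_counit Z := (ModuleCat.mono_iff_injective _).2 (kdualEval_injective hτ Z)

end ModuleCat
end ModuleDuality

/-! ### Global dimension of the opposite algebra -/

section GlobalDimension

open Opposite MulOpposite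
open scoped ModuleCat

/-- The action factors through the quotient by the Jacobson radical, a semisimple ring, and the
submodules over the two rings are the same. -/
lemma Module.IsTorsionBySet.isSemisimpleModule_of_jacobson {R M : Type*} [Ring R]
    [IsSemiprimaryRing R] [AddCommGroup M] [Module R M]
    (h : Module.IsTorsionBySet R M (Ring.jacobson R)) : IsSemisimpleModule R M := by
  let _ := h.module
  exact (h.semilinearMap.isSemisimpleModule_iff_of_bijective Function.bijective_id).2
    inferInstance

variable {k : Type u} [Field k] {A B : Type u} [Ring A] [Ring B] [Algebra k A] [Algebra k B]
  {τ : B →ₐ[k] Aᵐᵒᵖ} {σ : A →ₐ[k] Bᵐᵒᵖ}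

namespace ModuleCat

lemma isTorsionBySet_kdual_kdual (hσ : ∀ b, unop (σ (unop (τ b))) = b) {Y : ModuleCat.{u} B}
    {s : Set B} (h : Module.IsTorsionBySet B Y s) :
    Module.IsTorsionBySet B (kdual τ (kdual σ Y)) s := fun ψ b => kdual_ext fun f => by
  rw [kdual_smul_apply]
  have : unop (τ b.1) • f = 0 := kdual_ext fun y => by
    rw [kdual_smul_apply, hσ, h (a := b) (x := y), map_zero, kdual_zero_apply]
  rw [this, map_zero, kdual_zero_apply]

/-- A semisimple module over a semiprimary algebra is a retract of its double dual. -/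
lemma exists_retract_kdual_kdual [IsSemiprimaryRing B] (hσ : ∀ b, unop (σ (unop (τ b))) = b)
    {Y : ModuleCat.{u} B} (h : Module.IsTorsionBySet B Y (Ring.jacobson B)) :
    Nonempty (Retract Y (kdual τ (kdual σ Y))) := by
  have := (isTorsionBySet_kdual_kdual (τ := τ) hσ h).isSemisimpleModule_of_jacobson
  obtain ⟨r, hr⟩ := IsSemisimpleModule.extension_property
    (M := kdual τ (kdual σ Y)) (kdualEval σ hσ Y).hom (kdualEval_injective hσ Y)
    LinearMap.id
  exact ⟨{ i := kdualEval σ hσ Y, r := ModuleCat.ofHom (X := kdual τ (kdual σ Y)) (Y := Y) r,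
           retract := ModuleCat.hom_ext hr }⟩

end ModuleCat

/-- The global dimension of the opposite of a finite dimensional algebra is finite. -/
theorem FiniteGlobalDimension.of_antiEquiv [Module.Finite k B]
    (hτ : ∀ a, unop (τ (unop (σ a))) = a) (hσ : ∀ b, unop (σ (unop (τ b))) = b)
    (hA : FiniteGlobalDimension A) : FiniteGlobalDimension B := by
  obtain ⟨n, hn⟩ := hA
  have : IsArtinianRing B := IsArtinianRing.of_finite k B
  refine ⟨n, fun X => ⟨fun i hi Y => ?_⟩⟩
  change ExtVanishes X Y i
  -- Dévissage in the second variable along the radical filtration: it suffices to treat modules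
  -- killed by the radical and to pass from `JM` and `M/JM` to `M`.
  refine IsSemiprimaryRing.induction ℤ B Y (P := fun M _ _ _ => ExtVanishes X (ModuleCat.of B M) i)
    (fun M _ _ _ _ _ hM => ?_) (fun M _ _ _ _ h₁ h₂ => ?_)
  · obtain ⟨r⟩ := ModuleCat.exists_retract_kdual_kdual (τ := τ) hσ (Y := ModuleCat.of B M) hM
    refine ExtVanishes.of_retract_right r ?_
    -- The double dual has the form `D Z`, so its `Ext` is governed by `A`; the bound `n` is the
    -- same on both sides.
    refine ((ModuleCat.duality hτ hσ).extVanishes_iff X _ i).2 ?_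
    exact ExtVanishes.of_hasProjectiveDimensionLE (hn _) hi
  · let N := Ring.jacobson B • (⊤ : Submodule B M)
    have hS : (ModuleCat.shortComplexOfCompEqZero N.subtype N.mkQ (by ext; simp)).ShortExact :=
      ModuleCat.shortComplex_shortExact _ (LinearMap.exact_subtype_mkQ N) N.injective_subtype
        N.mkQ_surjective
    exact ExtVanishes.covariant₂ hS h₁ h₂

end GlobalDimension

/-! ### Tilting modules and their duals -/

section Tilting

section ExtSum

variable {C : Type v} [Category.{w} C] [Abelian C]

lemma ExtVanishes.of_sum_left {X Y T : C} {i n : ℕ} (p : Fin n → (X ⟶ T)) (q : Fin n → (T ⟶ X))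
    (h : ∑ j, p j ≫ q j = 𝟙 X) (hT : ExtVanishes T Y i) : ExtVanishes X Y i := by
  let := HasExt.standard C
  rw [extVanishes_iff] at hT ⊢
  intro e
  rw [← e.mk₀_id_comp, ← h, Abelian.Ext.mk₀_sum, Abelian.Ext.sum_comp]
  refine Finset.sum_eq_zero fun j _ => ?_
  rw [← Abelian.Ext.mk₀_comp_mk₀, Abelian.Ext.comp_assoc_of_second_deg_zero, hT (.comp _ _ _),
    Abelian.Ext.comp_zero]

lemma ExtVanishes.of_sum_right {X Y T : C} {i n : ℕ} (p : Fin n → (Y ⟶ T)) (q : Fin n → (T ⟶ Y))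
    (h : ∑ j, p j ≫ q j = 𝟙 Y) (hT : ExtVanishes X T i) : ExtVanishes X Y i := by
  let := HasExt.standard C
  rw [extVanishes_iff] at hT ⊢
  intro e
  rw [← e.comp_mk₀_id, ← h, Abelian.Ext.mk₀_sum, Abelian.Ext.comp_sum]
  refine Finset.sum_eq_zero fun j _ => ?_
  rw [← Abelian.Ext.mk₀_comp_mk₀, ← Abelian.Ext.comp_assoc_of_second_deg_zero, hT (.comp _ _ _),
    Abelian.Ext.zero_comp]

end ExtSum

open Opposite MulOpposite
open scoped ModuleCat

section Ring

variable {A : Type u} [Ring A] {T : ModuleCat.{u} A}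

/-- The maps are the components of a split embedding in `T^n` and of its retraction, whose kernel is
the complement. In this form membership in `add T` is visibly preserved by additive functors. -/
lemma inAdd_iff {M : ModuleCat.{u} A} : InAdd T M ↔
    ∃ (n : ℕ) (p : Fin n → (M ⟶ T)) (q : Fin n → (T ⟶ M)), ∑ j, p j ≫ q j = 𝟙 M := by
  constructor
  · rintro ⟨n, N, ⟨e⟩⟩
    refine ⟨n, fun j => ModuleCat.ofHom (LinearMap.proj j ∘ₗ e.toLinearMap ∘ₗ LinearMap.inl A M N),
      fun j => ModuleCat.ofHom (LinearMap.fst A M N ∘ₗ e.symm.toLinearMap ∘ₗ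
        LinearMap.single A (fun _ => T) j), ?_⟩
    ext m
    have h := Finset.univ_sum_single (e (m, 0))
    have h' := congrArg (fun t => (e.symm t).1) h
    simpa [ModuleCat.hom_sum, map_sum, Prod.fst_sum] using h'
  · rintro ⟨n, p, q, h⟩
    let i : M →ₗ[A] (Fin n → T) := LinearMap.pi fun j => (p j).hom
    let r : (Fin n → T) →ₗ[A] M := ∑ j, (q j).hom ∘ₗ LinearMap.proj j
    have hr : ∀ m, r (i m) = m := fun m => by
      have := congrArg (fun t => t.hom m) h
      simpa [ModuleCat.hom_sum, r, i] using this
    refine ⟨n, ModuleCat.of A (LinearMap.ker r), ⟨LinearEquiv.ofLinearMap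
      (i.coprod (LinearMap.ker r).subtype)
      (r.prod ((LinearMap.id - i ∘ₗ r).codRestrict _ fun x => by simp [hr])) ?_ ?_⟩⟩
    · ext x : 1
      simp
    · refine LinearMap.ext fun x => Prod.ext ?_ (Subtype.ext ?_)
      · simp [hr]
      · simp [hr]

lemma InAdd.of_iso {T' M : ModuleCat.{u} A} (e : T ≅ T') (h : InAdd T M) : InAdd T' M := by
  rw [inAdd_iff] at *
  obtain ⟨n, p, q, h⟩ := h
  exact ⟨n, fun j => p j ≫ e.hom, fun j => e.inv ≫ q j, by simpa using h⟩

lemma inAdd_pi (n : ℕ) : InAdd T (ModuleCat.of A (Fin n → T)) :=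
  ⟨n, ModuleCat.of A PUnit, ⟨LinearEquiv.prodUnique⟩⟩

lemma InAdd.extVanishes_left {M X : ModuleCat.{u} A} {i : ℕ} (h : InAdd T M)
    (hT : ExtVanishes T X i) : ExtVanishes M X i := by
  obtain ⟨n, p, q, h⟩ := inAdd_iff.1 h
  exact ExtVanishes.of_sum_left p q h hT

lemma InAdd.extVanishes_right {M X : ModuleCat.{u} A} {i : ℕ} (h : InAdd T M)
    (hT : ExtVanishes X T i) : ExtVanishes X M i := by
  obtain ⟨n, p, q, h⟩ := inAdd_iff.1 h
  exact ExtVanishes.of_sum_right p q h hT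

/-- There is an exact sequence `0 → Y → T_0 → ⋯ → T_n → 0` with all `T_i` in `add T`. -/
def HasAddCoresolution (T Y : ModuleCat.{u} A) (n : ℕ) : Prop :=
  ∃ (S : ℕ → ModuleCat.{u} A) (ε : Y →ₗ[A] S 0) (d : ∀ i, S i →ₗ[A] S (i + 1)),
    (∀ i, i ≤ n → InAdd T (S i)) ∧ (∀ i, n < i → Subsingleton (S i)) ∧
    Function.Injective ε ∧ Function.Exact ε (d 0) ∧ ∀ i, Function.Exact (d i) (d (i + 1))

namespace HasAddCoresolution

variable {Y : ModuleCat.{u} A} {n : ℕ}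

lemma zero (h : InAdd T Y) : HasAddCoresolution T Y 0 := by
  refine ⟨fun | 0 => Y | _ + 1 => ModuleCat.of A PUnit, LinearMap.id, fun _ => 0, ?_, ?_,
    Function.injective_id, fun y => by simp, fun i y => ?_⟩
  · rintro i hi
    obtain rfl : i = 0 := by omega
    exact h
  · rintro (_ | i) hi
    · omega
    · exact inferInstanceAs (Subsingleton PUnit)
  · have : Subsingleton ((fun | 0 => Y | _ + 1 => ModuleCat.of A PUnit : ℕ → ModuleCat.{u} A)
        (i + 1)) := inferInstanceAs (Subsingleton PUnit)
    exact ⟨fun _ => ⟨0, Subsingleton.elim _ _⟩, fun _ => rfl⟩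

lemma succ {M Y' : ModuleCat.{u} A} {f : Y →ₗ[A] M} {g : M →ₗ[A] Y'} (hf : Function.Injective f)
    (hfg : Function.Exact f g) (hg : Function.Surjective g) (hM : InAdd T M)
    (h : HasAddCoresolution T Y' n) : HasAddCoresolution T Y (n + 1) := by
  obtain ⟨S, ε, d, hS, hS', hε, hd₀, hd⟩ := h
  refine ⟨fun | 0 => M | i + 1 => S i, f, fun | 0 => ε ∘ₗ g | i + 1 => d i, ?_, ?_, hf, ?_, ?_⟩
  · rintro (_ | i) hi
    · exact hM
    · exact hS i (by omega)
  · rintro (_ | i) hi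
    · omega
    · exact hS' i (by omega)
  · intro m
    rw [← hfg m]
    exact map_eq_zero_iff ε hε
  · rintro (_ | i)
    · intro m
      refine (hd₀ m).trans ⟨?_, ?_⟩
      · rintro ⟨y, rfl⟩
        obtain ⟨x, rfl⟩ := hg y
        exact ⟨x, rfl⟩
      · rintro ⟨x, rfl⟩
        exact ⟨g x, rfl⟩
    · exact hd i

lemma inAdd (h : HasAddCoresolution T Y 0) : InAdd T Y := by
  obtain ⟨S, ε, d, hS, hS', hε, hd₀, hd⟩ := h
  have := hS' 1 zero_lt_one
  obtain ⟨n, N, ⟨e⟩⟩ := hS 0 le_rfl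
  have e' : Y ≃ₗ[A] S 0 := LinearEquiv.ofBijective ε
    ⟨hε, fun y => (hd₀ y).1 (Subsingleton.elim _ _)⟩
  exact ⟨n, N, ⟨(e'.prodCongr (LinearEquiv.refl A N)).trans e⟩⟩

lemma exists_shortExact (h : HasAddCoresolution T Y (n + 1)) :
    ∃ S : ShortComplex (ModuleCat.{u} A), S.ShortExact ∧ S.X₁ = Y ∧ InAdd T S.X₂ ∧
      HasAddCoresolution T S.X₃ n := by
  obtain ⟨S, ε, d, hS, hS', hε, hd₀, hd⟩ := h
  refine ⟨ModuleCat.shortComplexOfCompEqZero ε (d 0).rangeRestrict ?_,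
    ModuleCat.shortComplex_shortExact _ ?_ hε (d 0).surjective_rangeRestrict, rfl,
    hS 0 (by omega), fun i => S (i + 1), (LinearMap.range (d 0)).subtype, fun i => d (i + 1),
    fun i hi => hS _ (by omega), fun i hi => hS' _ (by omega), Subtype.val_injective, ?_,
    fun i => hd _⟩
  · exact LinearMap.ext fun y => Subtype.ext (hd₀.apply_apply_eq_zero y)
  · exact fun m => Subtype.ext_iff.trans (hd₀ m)
  · intro m
    rw [hd 0 m]
    exact ⟨fun h => ⟨⟨m, h⟩, rfl⟩, fun ⟨x, hx⟩ => hx ▸ x.2⟩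

/-- The first cosyzygy has a shorter coresolution, so its `Ext^{i+1}` vanishes by induction;
together with the vanishing on `add T` this gives `Ext^i` of `Y`. -/
lemma extVanishes {X : ModuleCat.{u} A} (hX : ∀ i, 0 < i → ExtVanishes T X i)
    (h : HasAddCoresolution T Y n) (i : ℕ) (hi : 0 < i) : ExtVanishes Y X i := by
  induction n generalizing Y i with
  | zero => exact h.inAdd.extVanishes_left (hX i hi)
  | succ n ih =>
    obtain ⟨S, hS, rfl, h₂, h₃⟩ := h.exists_shortExact
    exact ExtVanishes.contravariant₁ hS (h₂.extVanishes_left (hX i hi)) (ih h₃ _ i.succ_pos)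

/-- The obstruction to extending `f` to the first term of the coresolution lies in `Ext¹` of the
cosyzygy, which vanishes by `extVanishes`. -/
lemma exists_factorization {X : ModuleCat.{u} A} (hX : ∀ i, 0 < i → ExtVanishes T X i)
    (h : HasAddCoresolution T Y n) (f : Y ⟶ X) :
    ∃ (M : ModuleCat.{u} A) (ε : Y ⟶ M) (g : M ⟶ X), InAdd T M ∧ ε ≫ g = f := by
  obtain _ | n := n
  · exact ⟨Y, 𝟙 Y, f, h.inAdd, Category.id_comp f⟩
  · obtain ⟨S, hS, rfl, h₂, h₃⟩ := h.exists_shortExact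
    obtain ⟨g, hg⟩ := ExtVanishes.exists_extension hS (h₃.extVanishes hX 1 zero_lt_one) f
    exact ⟨S.X₂, S.f, g, h₂, hg⟩

lemma of_iso {T' Y' : ModuleCat.{u} A} (eT : T ≅ T') (eY : Y ≅ Y')
    (h : HasAddCoresolution T Y n) : HasAddCoresolution T' Y' n := by
  obtain ⟨S, ε, d, hS, hS', hε, hd₀, hd⟩ := h
  let e := eY.symm.toLinearEquiv
  refine ⟨S, ε ∘ₗ e.toLinearMap, d, fun i hi => (hS i hi).of_iso eT, hS', hε.comp e.injective,
    fun m => (hd₀ m).trans ⟨?_, ?_⟩, hd⟩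
  · rintro ⟨y, rfl⟩
    exact ⟨e.symm y, congrArg ε (e.apply_symm_apply y)⟩
  · rintro ⟨x, rfl⟩
    exact ⟨e x, rfl⟩

end HasAddCoresolution

lemma IsTiltingModule.of_iso {T' : ModuleCat.{u} A} (e : T ≅ T') (h : IsTiltingModule T) :
    IsTiltingModule T' where
  finite := have := h.finite; Module.Finite.equiv e.toLinearEquiv
  basic := h.basic.of_iso e.symm
  finite_projectiveDimension := by
    obtain ⟨n, hn⟩ := h.finite_projectiveDimension
    exact ⟨n, hasProjectiveDimensionLT_of_iso e _⟩
  ext_self i hi := (ExtVanishes.of_retract_left e.symm.retract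
    (ExtVanishes.of_retract_right e.symm.retract (h.ext_self i hi)))
  coresolution := by
    obtain ⟨n, hn⟩ := h.coresolution
    exact ⟨n, HasAddCoresolution.of_iso (Y := ModuleCat.of A A) e (Iso.refl _) hn⟩

end Ring

section Algebra

variable {k : Type u} [Field k] {A B : Type u} [Ring A] [Ring B] [Algebra k A] [Algebra k B]

/-- A module that is right orthogonal to a tilting module `T` admits a right `add T`-approximation,
which is surjective with kernel right orthogonal to `T`. -/
lemma exists_rightApproximation [Module.Finite k A] {T X : ModuleCat.{u} A} [Module.Finite A T]
    [Module.Finite A X] (hT : ∀ i, 0 < i → ExtVanishes T T i)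
    {n : ℕ} (hA : HasAddCoresolution T (ModuleCat.of A A) n)
    (hX : ∀ i, 0 < i → ExtVanishes T X i) :
    ∃ S : ShortComplex (ModuleCat.{u} A), S.ShortExact ∧ S.X₃ = X ∧ InAdd T S.X₂ ∧
      Module.Finite A S.X₁ ∧ ∀ i, 0 < i → ExtVanishes T S.X₁ i := by
  have : Module.Finite k T := Module.Finite.trans A T
  have : Module.Finite k X := Module.Finite.trans A X
  have : IsNoetherianRing A := IsNoetherianRing.of_finite k A
  have : Module.Finite k (T →ₗ[A] X) := Module.Finite.of_injective
    (LinearMap.restrictScalarsₗ k A T X k) (LinearMap.restrictScalars_injective k)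
  -- Taking a finite `k`-spanning family of `Hom(T, X)` as the components of `f` makes every map `T
  -- → X` factor through `f`.
  obtain ⟨m, s, hs⟩ := Module.Finite.exists_fin (R := k) (M := T →ₗ[A] X)
  let f : (Fin m → T) →ₗ[A] X := ∑ j, s j ∘ₗ LinearMap.proj j
  have hf : ∀ g : T →ₗ[A] X, ∃ g' : T →ₗ[A] (Fin m → T), f ∘ₗ g' = g := fun g => by
    obtain ⟨c, hc⟩ := (Submodule.mem_span_range_iff_exists_fun k).1
      (hs ▸ Submodule.mem_top : g ∈ Submodule.span k (Set.range s))
    refine ⟨LinearMap.pi fun j => c j • LinearMap.id, ?_⟩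
    rw [← hc]
    ext t
    simp [f, LinearMap.map_smul_of_tower]
  -- The map `A → X` sending `1` to `x` factors through a module in `add T`, and maps from `add T`
  -- to `X` have image in the range of `f`.
  have hsurj : Function.Surjective f := fun x => by
    obtain ⟨M, ε, g, hM, hg⟩ := hA.exists_factorization hX
      (ModuleCat.ofHom (LinearMap.toSpanSingleton A X x))
    obtain ⟨l, p, q, hpq⟩ := inAdd_iff.1 hM
    have key : ∀ y, g.hom y ∈ LinearMap.range f := fun y => by
      have h := congrArg (fun t => g.hom (t.hom y)) hpq
      simp only [ModuleCat.hom_sum, LinearMap.sum_apply, map_sum, ModuleCat.hom_comp,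
        LinearMap.comp_apply, ModuleCat.hom_id, LinearMap.id_apply] at h
      rw [← h]
      refine Submodule.sum_mem _ fun j _ => ?_
      obtain ⟨g', hg'⟩ := hf (g.hom ∘ₗ (q j).hom)
      exact ⟨g' ((p j).hom y), congrArg (fun t => t ((p j).hom y)) hg'⟩
    obtain ⟨t, ht⟩ := key (ε.hom 1)
    refine ⟨t, ht.trans ?_⟩
    have := congrArg (fun t => t.hom (1 : A)) hg
    simpa using this
  have hS := LinearMap.shortExact_shortComplexKer hsurj
  have hT' : ∀ i, 0 < i → ExtVanishes T (ModuleCat.of A (Fin m → T)) i := fun i hi =>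
    (inAdd_pi m).extVanishes_right (hT i hi)
  refine ⟨f.shortComplexKer, hS, rfl, inAdd_pi m,
    inferInstanceAs (Module.Finite A (LinearMap.ker f)), ?_⟩
  rintro (_ | _ | i) hi
  · omega
  -- `Ext¹` of `T` into the kernel vanishes by the approximation property; in higher degrees the
  -- orthogonality of `X` gives it by dimension shifting.
  · refine ExtVanishes.of_exists_lift hS (hT' 1 hi) fun g => ?_
    obtain ⟨g', hg'⟩ := hf g.hom
    exact ⟨ModuleCat.ofHom g', ModuleCat.hom_ext hg'⟩
  · exact ExtVanishes.covariant₁ hS (hX _ i.succ_pos) (hT' _ hi)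

variable {τ : B →ₐ[k] Aᵐᵒᵖ} {σ : A →ₐ[k] Bᵐᵒᵖ}

namespace ModuleCat

variable (k) in
lemma finite_of_finite [Module.Finite k B] (M : ModuleCat.{u} B) [Module.Finite B M] :
    Module.Finite k M := Module.Finite.trans B M

lemma inAdd_kdual {T M : ModuleCat.{u} A} (h : InAdd T M) :
    InAdd (kdual τ T) (kdual τ M) := by
  rw [inAdd_iff] at *
  obtain ⟨n, p, q, h⟩ := h
  refine ⟨n, fun j => kdualMap τ (q j), fun j => kdualMap τ (p j), ?_⟩
  refine ModuleCat.hom_ext (LinearMap.ext fun φ => kdual_ext fun x => ?_)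
  have h' := congrArg (fun t => φ (t.hom x)) h
  simp only [ModuleCat.hom_sum, LinearMap.sum_apply, map_sum, ModuleCat.hom_comp,
    LinearMap.comp_apply, ModuleCat.hom_id, LinearMap.id_apply] at h' ⊢
  refine Eq.trans ?_ h'
  exact LinearMap.sum_apply (M := M) (M₂ := k) (R := k) (R₂ := k) _ _ _

/-- Iterated right approximations resolve `X` by `add T`, and dualizing gives the coresolution. The
hypothesis `h` says that the dimension of `X` relative to modules right orthogonal to `T` is at most
`m`; each passage to a kernel lowers this by one. -/
lemma hasAddCoresolution_kdual [Module.Finite k A] {T : ModuleCat.{u} A} [Module.Finite A T]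
    (hT : ∀ i, 0 < i → ExtVanishes T T i)
    {n : ℕ} (hA : HasAddCoresolution T (ModuleCat.of A A) n) (m : ℕ) (X : ModuleCat.{u} A)
    [Module.Finite A X] (hX : ∀ i, 0 < i → ExtVanishes T X i)
    (h : ∀ (Y : ModuleCat.{u} A) [Module.Finite A Y], (∀ i, 0 < i → ExtVanishes T Y i) →
      ExtVanishes X Y (m + 1)) :
    HasAddCoresolution (kdual τ T) (kdual τ X) m := by
  induction m generalizing X with
  | zero =>
    obtain ⟨S, hS, rfl, h₂, h₁, h₁'⟩ := exists_rightApproximation (k := k) hT hA hX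
    -- For `m = 0` the kernel of the approximation has no `Ext¹` from `X`, so the approximation
    -- splits and `X` lies in `add T`.
    obtain ⟨g, hg⟩ := ExtVanishes.exists_lift hS (h S.X₁ h₁') (𝟙 _)
    refine .zero (inAdd_kdual (inAdd_iff.2 ?_))
    obtain ⟨l, p, q, hpq⟩ := inAdd_iff.1 h₂
    refine ⟨l, fun j => g ≫ p j, fun j => q j ≫ S.g, ?_⟩
    rw [← hg]
    have h' := congrArg (fun t => g ≫ t ≫ S.g) hpq
    simpa [Preadditive.sum_comp, Preadditive.comp_sum] using h'
  | succ m ih =>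
    obtain ⟨S, hS, rfl, h₂, h₁, h₁'⟩ := exists_rightApproximation (k := k) hT hA hX
    refine .succ (kdualMap_injective hS.moduleCat_surjective_g) (kdualMap_exact
      ((ShortComplex.ShortExact.moduleCat_exact_iff_function_exact _).1 hS.exact))
      (kdualMap_surjective hS.moduleCat_injective_f) (inAdd_kdual h₂)
      (ih S.X₁ h₁' fun Y _ hY => ?_)
    exact ExtVanishes.contravariant₁ hS (h₂.extVanishes_left (hY _ m.succ_pos)) (h Y hY)

/-- Over a finite dimensional algebra of finite global dimension, the dual of a tilting module is a
tilting module over the opposite algebra. -/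
theorem isTiltingModule_kdual [Module.Finite k A] [Module.Finite k B]
    (hτ : ∀ a, unop (τ (unop (σ a))) = a) (hσ : ∀ b, unop (σ (unop (τ b))) = b)
    (hA : FiniteGlobalDimension A) {T : ModuleCat.{u} A} (hT : IsTiltingModule T) :
    IsTiltingModule (kdual τ T) := by
  have := hT.finite
  have : Module.Finite k T := Module.Finite.trans A T
  have : IsIso ((duality hτ hσ).adj.counit.app (op T)) := by
    have h : IsIso (kdualEval τ hτ T) := (ConcreteCategory.isIso_iff_bijective _).2
      ⟨kdualEval_injective hτ T, kdualEval_surjective hτ T⟩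
    exact inferInstanceAs (IsIso (kdualEval τ hτ T).op)
  refine ⟨kdual_finite T, (duality hτ hσ).isBasicObject_obj hT.basic, ?_, fun i hi => ?_, ?_⟩
  · obtain ⟨n, hn⟩ := hA.of_antiEquiv hτ hσ
    exact ⟨n, hn _⟩
  · refine ((duality hτ hσ).extVanishes_iff _ T i).2 ?_
    exact ExtVanishes.of_retract_right
      (asIso ((duality hτ hσ).adj.counit.app (op T))).unop.symm.retract (hT.ext_self i hi)
  · obtain ⟨n, hn⟩ := hT.coresolution
    obtain ⟨m, hm⟩ := hA
    -- The dual of the regular module is injective, hence right orthogonal to `T`, and its own dual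
    -- is again `B`. The bound `m` on the global dimension of `A` serves as the length of the
    -- coresolution.
    let X := kdual σ (ModuleCat.of B B)
    have : Module.Finite A X := kdual_finite _
    have hI : Injective X := (duality hτ hσ).injective_of_projective (ModuleCat.of B B)
    have h := hasAddCoresolution_kdual (τ := τ) (k := k) hT.ext_self
      (n := n) hn m X (fun | i + 1, _ => .of_injective i)
      (fun Y _ _ => .of_hasProjectiveDimensionLE (hm X) m.lt_succ_self)
    have : Module.Finite B (ModuleCat.of B B) := Module.Finite.self B
    have := finite_of_finite k (ModuleCat.of B B)
    have : IsIso (kdualEval σ hσ (ModuleCat.of B B)) :=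
      (ConcreteCategory.isIso_iff_bijective _).2
        ⟨kdualEval_injective hσ _, kdualEval_surjective hσ _⟩
    exact ⟨m, h.of_iso (Iso.refl _) (asIso (kdualEval σ hσ (ModuleCat.of B B))).symm⟩

end ModuleCat

end Algebra

end Tilting

/-! ### Transfer of the Koszul conditions to the opposite algebra -/

section KoszulDual

open Opposite MulOpposite
open scoped ModuleCat

variable {k : Type u} [Field k] {Λ : Type u} [Ring Λ] [Algebra k Λ]
  (𝒜 : ℕ → Submodule k Λ) [GradedAlgebra 𝒜]

/-- The anti-isomorphism from `(Λᵒᵖ)_0` to `Λ_0`. -/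
noncomputable def opGradingZero : opGrading 𝒜 0 →ₐ[k] (𝒜 0)ᵐᵒᵖ where
  toFun b := op ⟨unop b.1, b.2⟩
  map_one' := rfl
  map_mul' _ _ := rfl
  map_zero' := rfl
  map_add' _ _ := rfl
  commutes' _ := rfl

/-- The anti-isomorphism from `Λ_0` to `(Λᵒᵖ)_0`. -/
noncomputable def toOpGradingZero : 𝒜 0 →ₐ[k] (opGrading 𝒜 0)ᵐᵒᵖ where
  toFun a := op ⟨op a.1, a.2⟩
  map_one' := rfl
  map_mul' _ _ := rfl
  map_zero' := rfl
  map_add' _ _ := rfl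
  commutes' _ := rfl

lemma opGradingZero_toOpGradingZero (a : 𝒜 0) :
    unop (opGradingZero 𝒜 (unop (toOpGradingZero 𝒜 a))) = a := rfl

lemma toOpGradingZero_opGradingZero (b : opGrading 𝒜 0) :
    unop (toOpGradingZero 𝒜 (unop (opGradingZero 𝒜 b))) = b := rfl

/-- The homogeneous parts of `Λᵒᵖ` are those of `Λ`. -/
def opGradingEquiv (i : ℕ) : 𝒜 i ≃ₗ[k] opGrading 𝒜 i where
  toFun a := ⟨op a.1, a.2⟩
  map_add' _ _ := rfl
  map_smul' _ _ := rfl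
  invFun b := ⟨unop b.1, b.2⟩
  left_inv _ := rfl
  right_inv _ := rfl

variable {𝒜}

/-- Since `k^r` is commutative, the augmentation maps remain algebra maps after the multiplication
of `Λ_0` is reversed. -/
lemma IsLocallyFiniteAugmented.opGrading (h : IsLocallyFiniteAugmented 𝒜) :
    IsLocallyFiniteAugmented (opGrading 𝒜) where
  finite i := have := h.finite i; Module.Finite.equiv (opGradingEquiv 𝒜 i)
  augmented := by
    obtain ⟨r, hr, σ, ε, hσ, hε⟩ := h.augmented
    refine ⟨r, hr,
      { toFun := fun x => unop (toOpGradingZero 𝒜 (σ x))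
        map_one' := by simp
        map_mul' := fun x y => by rw [mul_comm x y]; simp
        map_zero' := by simp
        map_add' := fun x y => by simp
        commutes' := fun c => by simp },
      { toFun := fun b => ε (unop (opGradingZero 𝒜 b))
        map_one' := by simp
        map_mul' := fun x y => by simp [mul_comm]
        map_zero' := by simp
        map_add' := fun x y => by simp
        commutes' := fun c => by simp }, hσ, fun b hb => ?_⟩
    obtain ⟨n, hn⟩ := hε _ hb
    refine ⟨n, ?_⟩
    have h := congrArg (fun a => unop (toOpGradingZero 𝒜 a)) hn
    simpa [toOpGradingZero_opGradingZero] using h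

namespace GrMod

/-- Two `k`-structures must be compared: the one induced through `Λ_0` and the given one on the
homogeneous part. -/
lemma degreeZero_smul (M : GrMod 𝒜) (c : k) (m : M.X 0) :
    (c • (show M.degreeZero from m) : M.degreeZero) = c • m := by
  change M.act 0 0 0 (by simp) (algebraMap k (𝒜 0) c) m = c • m
  rw [Algebra.algebraMap_eq_smul_one, map_smul, LinearMap.smul_apply]
  exact congrArg (c • ·) (M.one_act 0 (by simp) m)

/-- The degree zero part of the dual is the dual of the degree zero part. -/
noncomputable def dualDegreeZeroEquiv (M : GrMod 𝒜) :
    ModuleCat.kdual (opGradingZero 𝒜) M.degreeZero ≃ₗ[opGrading 𝒜 0] M.dual.degreeZero where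
  toFun φ := show Module.Dual k (M.X 0) from
    { toFun := fun m => φ m
      map_add' := map_add φ
      map_smul' := fun c m => (congrArg φ (M.degreeZero_smul c m)).symm.trans
        (ModuleCat.kdual_map_smul φ c m) }
  invFun φ := show Module.Dual k M.degreeZero from
    { toFun := fun m => (show Module.Dual k (M.X 0) from φ) m
      map_add' := map_add (show Module.Dual k (M.X 0) from φ)
      map_smul' := fun c m => (congrArg (show Module.Dual k (M.X 0) from φ)
        (M.degreeZero_smul c m)).trans
        (map_smul (show Module.Dual k (M.X 0) from φ) c (show M.X 0 from m)) }
  map_add' _ _ := rfl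
  map_smul' _ _ := rfl
  left_inv _ := rfl
  right_inv _ := rfl

/-- The degree zero part of the dual is isomorphic to the dual of the degree zero part. -/
noncomputable def dualDegreeZeroIso (M : GrMod 𝒜) :
    ModuleCat.kdual (opGradingZero 𝒜) M.degreeZero ≅ M.dual.degreeZero where
  hom := ModuleCat.ofHom (X := ModuleCat.kdual (opGradingZero 𝒜) M.degreeZero)
    (Y := M.dual.degreeZero) M.dualDegreeZeroEquiv.toLinearMap
  inv := ModuleCat.ofHom (X := M.dual.degreeZero)
    (Y := ModuleCat.kdual (opGradingZero 𝒜) M.degreeZero) M.dualDegreeZeroEquiv.symm.toLinearMap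
  hom_inv_id := ModuleCat.hom_ext (LinearMap.ext M.dualDegreeZeroEquiv.symm_apply_apply)
  inv_hom_id := ModuleCat.hom_ext (LinearMap.ext M.dualDegreeZeroEquiv.apply_symm_apply)

lemma ConcentratedInDegreeZero.dual {M : GrMod 𝒜} (h : M.ConcentratedInDegreeZero) :
    M.dual.ConcentratedInDegreeZero := fun i hi => by
  have := h (-i) (by omega)
  exact ⟨fun φ ψ => LinearMap.ext fun m => by
    rw [Subsingleton.elim m 0]
    exact (map_zero (show Module.Dual k (M.X (-i)) from φ)).trans
      (map_zero (show Module.Dual k (M.X (-i)) from ψ)).symm⟩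

lemma ConcentratedInDegreeZero.isFinitelyGenerated {M : GrMod 𝒜}
    (h : M.ConcentratedInDegreeZero) [Module.Finite k (M.X 0)] : M.IsFinitelyGenerated := by
  obtain ⟨n, s, hs⟩ := Module.Finite.exists_fin (R := k) (M := M.X 0)
  refine ⟨n, fun _ => 0, s, fun N _ hN i => ?_⟩
  by_cases hi : i = 0
  · subst hi
    rw [eq_top_iff, ← hs, Submodule.span_le]
    rintro _ ⟨j, rfl⟩
    exact hN j
  · have := h i hi
    exact Subsingleton.elim _ _

lemma ConcentratedInDegreeZero.finite {M : GrMod 𝒜} (h : M.ConcentratedInDegreeZero)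
    [h0 : Module.Finite k (M.X 0)] (i : ℤ) : Module.Finite k (M.X i) := by
  by_cases hi : i = 0
  · subst hi; exact h0
  · have := h i hi
    infer_instance

lemma finite_degreeZero [Module.Finite k (𝒜 0)] (M : GrMod 𝒜)
    [Module.Finite (𝒜 0) M.degreeZero] : Module.Finite k (M.X 0) := by
  have := ModuleCat.finite_of_finite k M.degreeZero
  exact Module.Finite.equiv (M := M.degreeZero) (N := M.X 0)
    { toFun := fun m => m
      map_add' := fun _ _ => rfl
      map_smul' := fun c m => M.degreeZero_smul c m
      invFun := fun m => m
      left_inv := fun _ => rfl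
      right_inv := fun _ => rfl }

/-- For a degreewise finite dimensional module, `T⟨j⟩` is the predual of `DT`. -/
noncomputable def shiftIsoPredualDual (j : ℤ) (T : GrMod 𝒜) [∀ i, Module.Finite k (T.X i)] :
    T.shift j ≅ T.dual.predual j :=
  mkIso (fun i => (T.castEquiv (show i - j = -(j - i) by omega)).trans (Module.evalEquiv k _))
    fun i s l h a m => LinearMap.ext fun φ =>
      congrArg (DFunLike.coe (F := Module.Dual k (T.X (-(j - l)))) φ)
        (T.act_castEquiv (by omega) (by omega) (by omega) (by omega) a m).symm

lemma isBasicObject_dual {T : GrMod 𝒜} [∀ i, Module.Finite k (T.X i)] (hT : IsBasicObject T) :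
    IsBasicObject T.dual := by
  have : IsIso ((duality 𝒜 0).adj.counit.app (op T)) := by
    have h : IsIso (evalCounit 0 T) := isIso_of_bijective _ fun i => evalCounit_bijective 0 T i
    exact inferInstanceAs (IsIso (evalCounit 0 T).op)
  exact ((duality 𝒜 0).isBasicObject_obj hT).of_iso T.dual.shiftZero.symm

/-- With the twist of the duality chosen to be `j`, the shift is absorbed into `D` on one side and
reappears as `D'(DT) ≅ T⟨j⟩` on the other. -/
lemma extVanishes_dual_shift {T : GrMod 𝒜} [∀ i, Module.Finite k (T.X i)] {i : ℕ} {j : ℤ}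
    (h : ExtVanishes T (T.shift j) i) : ExtVanishes T.dual (T.dual.shift j) i :=
  ((duality 𝒜 j).extVanishes_iff T.dual T i).2
    (ExtVanishes.of_retract_right (shiftIsoPredualDual j T).symm.retract h)

end GrMod

end KoszulDual

theorem theorem4p2 {k : Type u} [Field k] {Λ : Type u} [Ring Λ] [Algebra k Λ]
    (𝒜 : ℕ → Submodule k Λ) [GradedAlgebra 𝒜]
    (hΛ : IsLocallyFiniteAugmented 𝒜) (hgl : FiniteGlobalDimension (𝒜 0))
    (T : GrMod 𝒜) (hT : IsKoszulWithRespectTo 𝒜 T) :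
    IsLocallyFiniteAugmented (opGrading 𝒜) ∧ FiniteGlobalDimension (opGrading 𝒜 0) ∧
      IsKoszulWithRespectTo (opGrading 𝒜) T.dual := by
  have := hΛ.finite 0
  have := hΛ.opGrading.finite 0
  have hτ := opGradingZero_toOpGradingZero 𝒜
  have hσ := toOpGradingZero_opGradingZero 𝒜
  -- Finite generation over the finite dimensional algebra `Λ_0` makes `T` finite dimensional in
  -- every degree; this is where its reflexivity comes from.
  have := hT.tilting.finite
  have := T.finite_degreeZero
  have := hT.concentrated.finite
  have hD := hT.concentrated.dual
  have : Module.Finite k (T.dual.X 0) := inferInstanceAs (Module.Finite k (Module.Dual k (T.X 0)))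
  refine ⟨hΛ.opGrading, hgl.of_antiEquiv hτ hσ, hD, ?_, hD, hD.isFinitelyGenerated,
    GrMod.isBasicObject_dual hT.selfOrthogonal.basic,
    fun i j hij => GrMod.extVanishes_dual_shift (hT.selfOrthogonal.ext_shift i j hij)⟩
  exact (ModuleCat.isTiltingModule_kdual hτ hσ hgl hT.tilting).of_iso T.dualDegreeZeroIso
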